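/- Let $s\ge 2$ be an integer. Let $\mathbb Z_s$ be the space of $s$-adic integers $x=\sum_{j\ge 0}x_js^j$, $0\le x_j\le s-1$, with the product topology on digit sequences; it contains the non-negative integers through their base-$s$ expansions. Let $\mathcal V=\{(n,x): n=0,1,2,\dots,\ 0\le x<s^n\}$ and let $H=\ell^2(\mathcal V)$ with canonical orthonormal basis $E_{(n,x)}$. For $f\in C(\mathbb Z_s)$ let $M_f\in B(H)$, $M_fE_{(n,x)}=f(x)E_{(n,x)}$, and let $S\in B(H)$ be the Bernoulli shift $$SE_{(n,x)}=\frac1s\sum_{j=0}^{s-1}E_{(n+1,\,sx+j)}.$$ Let $A_S=C^*(S,M_f\mid f\in C(\mathbb Z_s))\subseteq B(H)$. For $0\le j<s$ put $S_j=s\,M_{\chi_j}S\in A_S$, where $\chi_j$ is the characteristic function of $\{x\in\mathbb Z_s: x_0=j\}$. Let $\mathcal K(H)$ be the algebra of compact operators on $H$, let $\mathcal U_\theta$ be the unitary $\mathcal U_\theta E_{(n,x)}=e^{2\pi i n\theta}E_{(n,x)}$, let $I_S=\{a\in\mathcal K(H):\mathcal U_\theta a\,\mathcal U_\theta^{-1}=a\text{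 for all }\theta\in\mathbb R\}$, and let $\mathcal I_S=C^*(aS^n\mid a\in I_S,\ n=0,1,\dots)$. Let $\mathcal O_s$ be the Cuntz algebra, i.e. the universal unital $C^*$-algebra with generators $u_0,\dots,u_{s-1}$ and relations $u_j^*u_k=\delta_{jk}1$, $\sum_ju_ju_j^*=1$, and let the Cuntz–Toeplitz algebra be the universal unital $C^*$-algebra with generators $t_0,\dots,t_{s-1}$ and relations $t_j^*t_k=\delta_{jk}1$. Then: 1. $A_S$ is the Cuntz–Toeplitz algebra: there is a $*$-isomorphism from the Cuntz–Toeplitz algebra onto $A_S$ that maps $t_j$ to $S_j$ for every $j$. 2. $\mathcal I_S=\mathcal K(H)$ as subalgebras of $B(H)$; in particular $\mathcal I_S\cong\mathcal K(H)$. 3. $\mathcal K(H)$ is an ideal contained in $A_S$, and $A_S/\mathcal K(H)\cong\mathcal O_s$ as $*$-algebras, by a $*$-isomorphism that maps the class of $S_j$ to $u_j$ for every $j$. Thus, with the inclusion and with the quotient map followed by this isomorphism, $$0\longrightarrow\mathcal K(H)\longrightarrow A_S\longrightarrow\mathcal O_s\longrightarrow0$$ is a short exact sequence. -/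

import Mathlib

/-- The free unital complex `*`-algebra on a set `ι` of generators: the algebra of the free monoid on
the letters `Sum.inl i` (the generators) and `Sum.inr i` (their formal adjoints). -/
def FreeStarAlg (ι : Type) : Type := MonoidAlgebra ℂ (FreeMonoid (ι ⊕ ι))

namespace FreeStarAlg

noncomputable instance (ι : Type) : Ring (FreeStarAlg ι) :=
  inferInstanceAs (Ring (MonoidAlgebra ℂ (FreeMonoid (ι ⊕ ι))))

noncomputable instance (ι : Type) : Algebra ℂ (FreeStarAlg ι) :=
  inferInstanceAs (Algebra ℂ (MonoidAlgebra ℂ (FreeMonoid (ι ⊕ ι))))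

/-- Words in the letters, as elements of the free `*`-algebra. -/
noncomputable def word (ι : Type) : FreeMonoid (ι ⊕ ι) →* FreeStarAlg ι :=
  MonoidAlgebra.of ℂ (FreeMonoid (ι ⊕ ι))

/-- A single letter, as an element of the free `*`-algebra. -/
noncomputable def letter {ι : Type} (l : ι ⊕ ι) : FreeStarAlg ι :=
  word ι (FreeMonoid.of l)

/-- The generator of the free `*`-algebra. -/
noncomputable def gen {ι : Type} (i : ι) : FreeStarAlg ι := letter (Sum.inl i)

theorem ringHom_ext {ι : Type} {B : Type*} [Ring B] {φ ψ : FreeStarAlg ι →+* B}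
    (hc : ∀ c : ℂ, φ (algebraMap ℂ _ c) = ψ (algebraMap ℂ _ c))
    (hl : ∀ l, φ (letter l) = ψ (letter l)) : φ = ψ := by
  refine MonoidAlgebra.ringHom_ext (f := φ) (g := ψ) (fun c => hc c) ?_
  intro w
  change φ (word ι w) = ψ (word ι w)
  induction w using FreeMonoid.inductionOn' with
  | one => simp
  | of_mul l w ih =>
    rw [map_mul (word ι), map_mul φ, map_mul ψ, ih]
    exact congrArg (· * _) (hl l)

/-- Conjugation of scalars, with values in the opposite algebra. -/
noncomputable def conjOp (ι : Type) : ℂ →+* (FreeStarAlg ι)ᵐᵒᵖ :=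
  (algebraMap ℂ (FreeStarAlg ι)ᵐᵒᵖ).comp (starRingEnd ℂ)

/-- Reversal of words, exchanging generators and formal adjoints. -/
noncomputable def wordOp (ι : Type) : FreeMonoid (ι ⊕ ι) →* (FreeStarAlg ι)ᵐᵒᵖ :=
  FreeMonoid.lift fun l => MulOpposite.op (letter l.swap)

theorem conjOp_commute {ι : Type} (c : ℂ) (w : FreeMonoid (ι ⊕ ι)) :
    Commute (conjOp ι c) (wordOp ι w) :=
  Algebra.commutes (starRingEnd ℂ c) (wordOp ι w)

/-- Conjugate-linear reversal of words, exchanging generators and formal adjoints. -/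
noncomputable def starHom (ι : Type) : FreeStarAlg ι →+* (FreeStarAlg ι)ᵐᵒᵖ :=
  MonoidAlgebra.liftNCRingHom (conjOp ι) (wordOp ι) conjOp_commute

theorem starHom_letter {ι : Type} (l : ι ⊕ ι) :
    starHom ι (letter l) = MulOpposite.op (letter l.swap) := by
  refine (MonoidAlgebra.liftNCRingHom_single _ _ conjOp_commute _ _).trans ?_
  simp [conjOp, wordOp]

theorem starHom_algebraMap {ι : Type} (c : ℂ) :
    starHom ι (algebraMap ℂ _ c) = algebraMap ℂ _ (starRingEnd ℂ c) := by
  refine (MonoidAlgebra.liftNCRingHom_single _ _ conjOp_commute _ _).trans ?_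
  simp [conjOp, wordOp]

theorem starHom_starHom {ι : Type} (x : FreeStarAlg ι) :
    (starHom ι (starHom ι x).unop).unop = x := by
  let φ : FreeStarAlg ι →+* FreeStarAlg ι :=
    { toFun := fun x => (starHom ι (starHom ι x).unop).unop
      map_one' := by simp
      map_zero' := by simp
      map_mul' := by intro x y; simp
      map_add' := by intro x y; simp }
  have h : φ = RingHom.id _ := by
    apply ringHom_ext
    · intro c
      change (starHom ι (starHom ι (algebraMap ℂ _ c)).unop).unop = algebraMap ℂ _ c
      rw [starHom_algebraMap, MulOpposite.algebraMap_apply, MulOpposite.unop_op,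
        starHom_algebraMap]
      simp
    · intro l
      change (starHom ι (starHom ι (letter l)).unop).unop = letter l
      simp [starHom_letter]
  exact congrArg (fun f : FreeStarAlg ι →+* FreeStarAlg ι => f x) h

noncomputable instance (ι : Type) : StarRing (FreeStarAlg ι) where
  star x := (starHom ι x).unop
  star_involutive := starHom_starHom
  star_mul x y := by simp
  star_add x y := by simp

theorem star_letter {ι : Type} (l : ι ⊕ ι) : star (letter l) = letter l.swap :=
  congrArg MulOpposite.unop (starHom_letter l)

theorem star_algebraMap' {ι : Type} (c : ℂ) :
    star (algebraMap ℂ (FreeStarAlg ι) c) = algebraMap ℂ _ (starRingEnd ℂ c) :=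
  congrArg MulOpposite.unop (starHom_algebraMap c)

noncomputable instance (ι : Type) : StarModule ℂ (FreeStarAlg ι) where
  star_smul c x := by
    rw [Algebra.smul_def, star_mul, star_algebraMap', Algebra.smul_def, Algebra.commutes]
    rfl

/-- Evaluation of `*`-polynomials on a family of elements of a `*`-algebra. -/
noncomputable def eval {ι : Type} {B : Type*} [Ring B] [StarRing B] [Algebra ℂ B] [StarModule ℂ B]
    (v : ι → B) : FreeStarAlg ι →⋆ₐ[ℂ] B :=
  let φ : FreeStarAlg ι →ₐ[ℂ] B := MonoidAlgebra.lift ℂ B (FreeMonoid (ι ⊕ ι))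
    (FreeMonoid.lift (Sum.elim v fun i => star (v i)))
  have hφ : ∀ l, φ (letter l) = Sum.elim v (fun i => star (v i)) l := fun l => by
    refine (MonoidAlgebra.lift_of _ _).trans ?_
    simp
  { φ with
    map_star' := by
      let ψ : FreeStarAlg ι →+* B :=
        { toFun := fun x => star (φ (star x))
          map_one' := by simp
          map_zero' := by simp
          map_mul' := by intro x y; simp
          map_add' := by intro x y; simp }
      have h : ψ = (φ : FreeStarAlg ι →+* B) := by
        apply ringHom_ext
        · intro c
          change star (φ (star (algebraMap ℂ _ c))) = φ (algebraMap ℂ _ c)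
          rw [star_algebraMap', AlgHom.commutes, AlgHom.commutes, starRingEnd_apply,
            algebraMap_star_comm, star_star]
        · intro l
          change star (φ (star (letter l))) = φ (letter l)
          rw [star_letter, hφ, hφ]
          cases l <;> simp
      intro x
      have := congrArg (fun f : FreeStarAlg ι →+* B => star (f x)) h
      simpa [ψ] using this }

theorem eval_gen {ι : Type} {B : Type*} [Ring B] [StarRing B] [Algebra ℂ B] [StarModule ℂ B]
    (v : ι → B) (i : ι) : eval v (gen i) = v i := by
  refine (MonoidAlgebra.lift_of (R := ℂ) (A := B) _ _).trans ?_
  simp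

theorem starAlgHom_ext {ι : Type} {B : Type*} [Ring B] [StarRing B] [Algebra ℂ B]
    {φ ψ : FreeStarAlg ι →⋆ₐ[ℂ] B} (h : ∀ i, φ (gen i) = ψ (gen i)) : φ = ψ := by
  have hr : (φ.toAlgHom : FreeStarAlg ι →+* B) = (ψ.toAlgHom : FreeStarAlg ι →+* B) := by
    apply ringHom_ext
    · intro c
      exact (AlgHom.commutes φ.toAlgHom c).trans (AlgHom.commutes ψ.toAlgHom c).symm
    · rintro (i | i)
      · exact h i
      · have : (letter (Sum.inr i) : FreeStarAlg ι) = star (gen i) := (star_letter (Sum.inl i)).symm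
        rw [this]
        change φ (star (gen i)) = ψ (star (gen i))
        rw [map_star, map_star, h i]
  ext x
  exact congrArg (fun f : FreeStarAlg ι →+* B => f x) hr

end FreeStarAlg

/-- A C⋆-seminorm on the free `*`-algebra that vanishes on the set `R` of relators. -/
structure CStarSeminorm {ι : Type} (R : Set (FreeStarAlg ι)) where
  p : Seminorm ℂ (FreeStarAlg ι)
  mul_le : ∀ x y, p (x * y) ≤ p x * p y
  star_mul_self : ∀ x, p (star x * x) = p x ^ 2
  rel : ∀ r ∈ R, p r = 0

/-- The C⋆-seminorms vanishing on `R` are pointwise bounded. This is the condition under which the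
universal C⋆-algebra with relators `R` exists. -/
class AdmissibleRelators {ι : Type} (R : Set (FreeStarAlg ι)) : Prop where
  bdd : ∀ x, BddAbove (Set.range fun q : CStarSeminorm R => q.p x)

namespace CStarSeminorm

variable {ι : Type} {R : Set (FreeStarAlg ι)}

instance : Nonempty (CStarSeminorm R) :=
  ⟨⟨0, by simp, by simp, by simp⟩⟩

theorem p_star (q : CStarSeminorm R) (x : FreeStarAlg ι) : q.p (star x) = q.p x := by
  have key : ∀ y, q.p y ≤ q.p (star y) := by
    intro y
    by_contra h
    push Not at h
    have h1 := q.mul_le (star y) y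
    rw [q.star_mul_self] at h1
    have h2 : 0 ≤ q.p (star y) := apply_nonneg _ _
    nlinarith
  exact le_antisymm (by simpa using key (star x)) (key x)

theorem p_one_le (q : CStarSeminorm R) : q.p 1 ≤ 1 := by
  have h := q.star_mul_self 1
  rw [star_one, mul_one] at h
  have h2 : 0 ≤ q.p 1 := apply_nonneg _ _
  nlinarith

/-- A C⋆-algebra with a family satisfying the relations gives a C⋆-seminorm. -/
noncomputable def ofFamily {B : Type*} [CStarAlgebra B] (v : ι → B)
    (hv : ∀ r ∈ R, FreeStarAlg.eval v r = 0) : CStarSeminorm R where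
  p := (normSeminorm ℂ B).comp (FreeStarAlg.eval v).toAlgHom.toLinearMap
  mul_le x y := by
    change ‖FreeStarAlg.eval v (x * y)‖ ≤ ‖FreeStarAlg.eval v x‖ * ‖FreeStarAlg.eval v y‖
    rw [map_mul]
    exact norm_mul_le _ _
  star_mul_self x := by
    change ‖FreeStarAlg.eval v (star x * x)‖ = ‖FreeStarAlg.eval v x‖ ^ 2
    rw [map_mul, map_star, CStarRing.norm_star_mul_self, sq]
  rel r hr := by
    change ‖FreeStarAlg.eval v r‖ = 0
    rw [hv r hr, norm_zero]

theorem ofFamily_p {B : Type*} [CStarAlgebra B] (v : ι → B)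
    (hv : ∀ r ∈ R, FreeStarAlg.eval v r = 0) (x : FreeStarAlg ι) :
    (ofFamily v hv).p x = ‖FreeStarAlg.eval v x‖ := rfl

end CStarSeminorm

/-- The largest C⋆-seminorm on the free `*`-algebra that vanishes on the relators. -/
noncomputable def maxCStarSeminorm {ι : Type} (R : Set (FreeStarAlg ι)) [AdmissibleRelators R] :
    RingSeminorm (FreeStarAlg ι) where
  toFun x := ⨆ q : CStarSeminorm R, q.p x
  map_zero' := by simp
  add_le' x y := ciSup_le fun q => (map_add_le_add q.p x y).trans
    (add_le_add (le_ciSup (AdmissibleRelators.bdd x) q) (le_ciSup (AdmissibleRelators.bdd y) q))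
  neg' x := by simp
  mul_le' x y := ciSup_le fun q => (q.mul_le x y).trans
    (mul_le_mul (le_ciSup (AdmissibleRelators.bdd x) q) (le_ciSup (AdmissibleRelators.bdd y) q)
      (apply_nonneg _ _) (Real.iSup_nonneg fun _ => apply_nonneg _ _))

/-- The free `*`-algebra, equipped with the largest C⋆-seminorm vanishing on the relators. -/
def PreUnivCStar {ι : Type} (_R : Set (FreeStarAlg ι)) : Type := FreeStarAlg ι

namespace PreUnivCStar

variable {ι : Type} (R : Set (FreeStarAlg ι)) [AdmissibleRelators R]

noncomputable instance : SeminormedRing (PreUnivCStar R) :=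
  RingSeminorm.toSeminormedRing (R := FreeStarAlg ι) (maxCStarSeminorm R)

noncomputable instance : Algebra ℂ (PreUnivCStar R) :=
  inferInstanceAs (Algebra ℂ (FreeStarAlg ι))

noncomputable instance : StarRing (PreUnivCStar R) :=
  inferInstanceAs (StarRing (FreeStarAlg ι))

noncomputable instance : StarModule ℂ (PreUnivCStar R) :=
  inferInstanceAs (StarModule ℂ (FreeStarAlg ι))

theorem norm_def (x : PreUnivCStar R) : ‖x‖ = ⨆ q : CStarSeminorm R, q.p x := rfl

theorem p_le_norm (q : CStarSeminorm R) (x : PreUnivCStar R) : q.p x ≤ ‖x‖ :=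
  le_ciSup (f := fun q : CStarSeminorm R => q.p x) (AdmissibleRelators.bdd x) q

theorem norm_le (x : PreUnivCStar R) {c : ℝ} (h : ∀ q : CStarSeminorm R, q.p x ≤ c) : ‖x‖ ≤ c :=
  ciSup_le h

noncomputable instance : NormedAlgebra ℂ (PreUnivCStar R) where
  norm_smul_le c x := norm_le R _ fun q => by
    refine (map_smul_eq_mul q.p c x).trans_le ?_
    exact mul_le_mul_of_nonneg_left (p_le_norm R q x) (norm_nonneg _)

instance : NormedStarGroup (PreUnivCStar R) where
  norm_star_le x := norm_le R _ fun q => (q.p_star x).trans_le (p_le_norm R q x)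

theorem norm_mul_self_le (x : PreUnivCStar R) : ‖x‖ * ‖x‖ ≤ ‖star x * x‖ := by
  have h : ‖x‖ ≤ Real.sqrt ‖star x * x‖ := norm_le R x fun q =>
    Real.le_sqrt_of_sq_le ((q.star_mul_self x).symm.le.trans (p_le_norm R q (star x * x)))
  calc ‖x‖ * ‖x‖ ≤ Real.sqrt ‖star x * x‖ * Real.sqrt ‖star x * x‖ :=
        mul_self_le_mul_self (norm_nonneg x) h
    _ = ‖star x * x‖ := Real.mul_self_sqrt (norm_nonneg _)

end PreUnivCStar

/-- The universal unital C⋆-algebra with generators indexed by `ι` and relators `R`. -/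
def UnivCStar {ι : Type} (R : Set (FreeStarAlg ι)) [AdmissibleRelators R] : Type :=
  UniformSpace.Completion (PreUnivCStar R)

namespace UnivCStar

variable {ι : Type} (R : Set (FreeStarAlg ι)) [AdmissibleRelators R]

noncomputable instance : NormedRing (UnivCStar R) :=
  inferInstanceAs (NormedRing (UniformSpace.Completion (PreUnivCStar R)))

instance : CompleteSpace (UnivCStar R) :=
  inferInstanceAs (CompleteSpace (UniformSpace.Completion (PreUnivCStar R)))

noncomputable instance : NormedAlgebra ℂ (UnivCStar R) where
  toAlgebra := inferInstanceAs (Algebra ℂ (UniformSpace.Completion (PreUnivCStar R)))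
  norm_smul_le c x :=
    norm_smul_le c (show UniformSpace.Completion (PreUnivCStar R) from x)

/-- The canonical map from the free `*`-algebra. -/
noncomputable def mk (x : PreUnivCStar R) : UnivCStar R :=
  (x : UniformSpace.Completion (PreUnivCStar R))

theorem mk_add (x y : PreUnivCStar R) : mk R (x + y) = mk R x + mk R y :=
  UniformSpace.Completion.coe_add x y

theorem mk_mul (x y : PreUnivCStar R) : mk R (x * y) = mk R x * mk R y :=
  UniformSpace.Completion.coe_mul x y

theorem mk_one : mk R 1 = 1 := UniformSpace.Completion.coe_one _

theorem mk_zero : mk R 0 = 0 := UniformSpace.Completion.coe_zero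

theorem mk_smul (c : ℂ) (x : PreUnivCStar R) : mk R (c • x) = c • mk R x :=
  UniformSpace.Completion.coe_smul c x

theorem norm_mk (x : PreUnivCStar R) : ‖mk R x‖ = ‖x‖ := UniformSpace.Completion.norm_coe x

theorem continuous_mk : Continuous (mk R) := UniformSpace.Completion.continuous_coe _

theorem denseRange_mk : DenseRange (mk R) := UniformSpace.Completion.denseRange_coe

noncomputable instance : Star (UnivCStar R) where
  star := UniformSpace.Completion.map (star : PreUnivCStar R → PreUnivCStar R)

theorem star_mk (x : PreUnivCStar R) : star (mk R x) = mk R (star x) :=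
  UniformSpace.Completion.map_coe star_isometry.uniformContinuous x

theorem continuous_star' : Continuous (star : UnivCStar R → UnivCStar R) :=
  UniformSpace.Completion.continuous_map

variable {R} in
theorem ind {P : UnivCStar R → Prop} (hc : IsClosed {x | P x}) (h : ∀ x, P (mk R x)) (x) : P x :=
  (denseRange_mk R).induction_on x hc h

noncomputable instance : StarRing (UnivCStar R) where
  star_involutive x := by
    induction x using ind with
    | hc => exact isClosed_eq ((continuous_star' R).comp (continuous_star' R)) continuous_id
    | h x => rw [star_mk, star_mk, star_star]
  star_mul x y := by
    have := continuous_star' R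
    induction x using ind with
    | hc => apply isClosed_eq <;> fun_prop
    | h x =>
      induction y using ind with
      | hc => apply isClosed_eq <;> fun_prop
      | h y => rw [← mk_mul, star_mk, star_mk, star_mk, star_mul, mk_mul]
  star_add x y := by
    have := continuous_star' R
    induction x using ind with
    | hc => apply isClosed_eq <;> fun_prop
    | h x =>
      induction y using ind with
      | hc => apply isClosed_eq <;> fun_prop
      | h y => rw [← mk_add, star_mk, star_mk, star_mk, star_add, mk_add]

instance : CStarRing (UnivCStar R) where
  norm_mul_self_le x := by
    have := continuous_star' R
    induction x using ind with
    | hc => apply isClosed_le <;> fun_prop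
    | h x =>
      rw [star_mk, ← mk_mul, norm_mk, norm_mk]
      exact PreUnivCStar.norm_mul_self_le R x

instance : StarModule ℂ (UnivCStar R) where
  star_smul c x := by
    induction x using ind with
    | hc =>
      exact isClosed_eq ((continuous_star' R).comp (continuous_const_smul c))
        ((continuous_star' R).const_smul (star c))
    | h x => rw [← mk_smul, star_mk, star_mk, star_smul, mk_smul]

noncomputable instance : CStarAlgebra (UnivCStar R) where

/-- The canonical `*`-homomorphism from the free `*`-algebra. -/
noncomputable def ofFree : FreeStarAlg ι →⋆ₐ[ℂ] UnivCStar R where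
  toFun := mk R
  map_one' := mk_one R
  map_mul' := mk_mul R
  map_zero' := mk_zero R
  map_add' := mk_add R
  commutes' c := by
    rw [Algebra.algebraMap_eq_smul_one, Algebra.algebraMap_eq_smul_one]
    exact (mk_smul R c 1).trans (congrArg _ (mk_one R))
  map_star' x := (star_mk R x).symm

/-- The canonical generators of the universal C⋆-algebra. -/
noncomputable def gen (i : ι) : UnivCStar R := ofFree R (FreeStarAlg.gen i)

theorem eval_gen : FreeStarAlg.eval (gen R) = ofFree R :=
  FreeStarAlg.starAlgHom_ext fun _ => FreeStarAlg.eval_gen _ _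

/-- The canonical generators satisfy the relations. -/
theorem eval_gen_rel (r : FreeStarAlg ι) (hr : r ∈ R) : FreeStarAlg.eval (gen R) r = 0 := by
  rw [eval_gen]
  refine norm_eq_zero.1 ((norm_mk R r).trans (le_antisymm ?_ (norm_nonneg _)))
  exact PreUnivCStar.norm_le R _ fun q => (q.rel r hr).le

theorem norm_eval_le {B : Type*} [CStarAlgebra B] (v : ι → B)
    (hv : ∀ r ∈ R, FreeStarAlg.eval v r = 0) (x : PreUnivCStar R) :
    ‖FreeStarAlg.eval v x‖ ≤ ‖x‖ :=
  PreUnivCStar.p_le_norm R (CStarSeminorm.ofFamily v hv) x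

/-- Evaluation, extended to the universal C⋆-algebra by continuity. -/
noncomputable def liftFun {B : Type*} [CStarAlgebra B] (v : ι → B) : UnivCStar R → B :=
  UniformSpace.Completion.extension (fun x : PreUnivCStar R => FreeStarAlg.eval v x)

theorem continuous_liftFun {B : Type*} [CStarAlgebra B] (v : ι → B) :
    Continuous (liftFun R v) :=
  UniformSpace.Completion.continuous_extension

theorem liftFun_mk {B : Type*} [CStarAlgebra B] (v : ι → B)
    (hv : ∀ r ∈ R, FreeStarAlg.eval v r = 0) (x : PreUnivCStar R) :
    liftFun R v (mk R x) = FreeStarAlg.eval v x := by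
  refine UniformSpace.Completion.extension_coe ?_ x
  refine (LipschitzWith.of_dist_le_mul (K := 1) fun x y => ?_).uniformContinuous
  rw [NNReal.coe_one, one_mul, dist_eq_norm, dist_eq_norm]
  exact (congrArg norm (map_sub (FreeStarAlg.eval v) x y)).symm.le.trans
    (norm_eval_le R v hv (x - y))

/-- The unital `*`-homomorphism determined by a family that satisfies the relations. -/
noncomputable def lift {B : Type*} [CStarAlgebra B] (v : ι → B)
    (hv : ∀ r ∈ R, FreeStarAlg.eval v r = 0) : UnivCStar R →⋆ₐ[ℂ] B where
  toFun := liftFun R v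
  map_one' := by
    rw [← mk_one, liftFun_mk R v hv]
    exact map_one (FreeStarAlg.eval v)
  map_zero' := by
    rw [← mk_zero, liftFun_mk R v hv]
    exact map_zero (FreeStarAlg.eval v)
  map_mul' x y := by
    have := continuous_liftFun R v
    induction x using ind with
    | hc => apply isClosed_eq <;> fun_prop
    | h x =>
      induction y using ind with
      | hc => apply isClosed_eq <;> fun_prop
      | h y =>
        rw [← mk_mul, liftFun_mk R v hv, liftFun_mk R v hv, liftFun_mk R v hv]
        exact map_mul (FreeStarAlg.eval v) x y
  map_add' x y := by
    have := continuous_liftFun R v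
    induction x using ind with
    | hc => apply isClosed_eq <;> fun_prop
    | h x =>
      induction y using ind with
      | hc => apply isClosed_eq <;> fun_prop
      | h y =>
        rw [← mk_add, liftFun_mk R v hv, liftFun_mk R v hv, liftFun_mk R v hv]
        exact map_add (FreeStarAlg.eval v) x y
  commutes' c := by
    rw [← AlgHomClass.commutes (ofFree R) c]
    exact (liftFun_mk R v hv (algebraMap ℂ (FreeStarAlg ι) c)).trans
      (AlgHomClass.commutes (FreeStarAlg.eval v) c)
  map_star' x := by
    have := continuous_liftFun R v
    have := continuous_star' R
    induction x using ind with
    | hc => apply isClosed_eq <;> fun_prop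
    | h x =>
      rw [star_mk, liftFun_mk R v hv, liftFun_mk R v hv]
      exact map_star (FreeStarAlg.eval v) x

theorem lift_gen {B : Type*} [CStarAlgebra B] (v : ι → B)
    (hv : ∀ r ∈ R, FreeStarAlg.eval v r = 0) (i : ι) : lift R v hv (gen R i) = v i :=
  (liftFun_mk R v hv (FreeStarAlg.gen i)).trans (FreeStarAlg.eval_gen v i)

/-- The universal property: a family in a unital C⋆-algebra that satisfies the relations is the
image of the canonical generators under exactly one unital `*`-homomorphism. -/
theorem existsUnique_lift {B : Type*} [CStarAlgebra B] (v : ι → B)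
    (hv : ∀ r ∈ R, FreeStarAlg.eval v r = 0) :
    ∃! φ : UnivCStar R →⋆ₐ[ℂ] B, ∀ i, φ (gen R i) = v i := by
  refine ⟨lift R v hv, lift_gen R v hv, fun φ hφ => ?_⟩
  have h : φ.comp (ofFree R) = (lift R v hv).comp (ofFree R) :=
    FreeStarAlg.starAlgHom_ext fun i => (hφ i).trans (lift_gen R v hv i).symm
  have h1 : Continuous φ := AddMonoidHomClass.continuous_of_bound φ 1 fun x => by
    rw [one_mul]
    exact NonUnitalStarAlgHom.norm_apply_le φ x
  have h2 : Continuous (lift R v hv) := continuous_liftFun R v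
  ext x
  induction x using ind with
  | hc => exact isClosed_eq h1 h2
  | h x => exact congrArg (fun f : FreeStarAlg ι →⋆ₐ[ℂ] B => f x) h

end UnivCStar

/-! ### Cuntz and Cuntz–Toeplitz algebras -/

/-- The relators `u_j^* u_k - δ_{jk} 1`: isometries with pairwise orthogonal ranges. -/
def cuntzToeplitzRelators (s : ℕ) : Set (FreeStarAlg (Fin s)) :=
  Set.range fun jk : Fin s × Fin s =>
    star (FreeStarAlg.gen jk.1) * FreeStarAlg.gen jk.2 - if jk.1 = jk.2 then 1 else 0

/-- The relators `u_j^* u_k - δ_{jk} 1` and `∑ u_j u_j^* - 1`. -/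
def cuntzRelators (s : ℕ) : Set (FreeStarAlg (Fin s)) :=
  insert (∑ j : Fin s, FreeStarAlg.gen j * star (FreeStarAlg.gen j) - 1) (cuntzToeplitzRelators s)

theorem admissible_of_isometries {ι : Type} {R : Set (FreeStarAlg ι)}
    (h : ∀ i, star (FreeStarAlg.gen i) * FreeStarAlg.gen i - 1 ∈ R) : AdmissibleRelators R := by
  have hgen : ∀ (q : CStarSeminorm R) (i : ι), q.p (FreeStarAlg.gen i) ≤ 1 := by
    intro q i
    have h1 : q.p (FreeStarAlg.gen i) ^ 2 ≤ 1 := by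
      rw [← q.star_mul_self]
      calc q.p (star (FreeStarAlg.gen i) * FreeStarAlg.gen i)
          = q.p ((star (FreeStarAlg.gen i) * FreeStarAlg.gen i - 1) + 1) := by simp
        _ ≤ q.p (star (FreeStarAlg.gen i) * FreeStarAlg.gen i - 1) + q.p 1 := map_add_le_add _ _ _
        _ ≤ 1 := by rw [q.rel _ (h i), zero_add]; exact q.p_one_le
    have h2 : 0 ≤ q.p (FreeStarAlg.gen i) := apply_nonneg _ _
    nlinarith
  have hletter : ∀ (q : CStarSeminorm R) (l : ι ⊕ ι), q.p (FreeStarAlg.letter l) ≤ 1 := by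
    rintro q (i | i)
    · exact hgen q i
    · have : (FreeStarAlg.letter (Sum.inr i) : FreeStarAlg ι) = star (FreeStarAlg.gen i) :=
        (FreeStarAlg.star_letter (Sum.inl i)).symm
      rw [this, q.p_star]
      exact hgen q i
  have hword : ∀ (q : CStarSeminorm R) (w : FreeMonoid (ι ⊕ ι)),
      q.p (FreeStarAlg.word ι w) ≤ 1 := by
    intro q w
    induction w using FreeMonoid.inductionOn' with
    | one => rw [map_one]; exact q.p_one_le
    | of_mul l w ih =>
      rw [map_mul]
      refine (q.mul_le _ _).trans ?_
      exact mul_le_one₀ (hletter q l) (apply_nonneg _ _) ih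
  refine ⟨fun x => ?_⟩
  suffices hx : ∃ C, ∀ q : CStarSeminorm R, q.p x ≤ C by
    obtain ⟨C, hC⟩ := hx
    exact ⟨C, by rintro _ ⟨q, rfl⟩; exact hC q⟩
  refine MonoidAlgebra.induction_linear
    (motive := fun x : MonoidAlgebra ℂ (FreeMonoid (ι ⊕ ι)) =>
      ∃ C, ∀ q : CStarSeminorm R, q.p (show FreeStarAlg ι from x) ≤ C) x ?_ ?_ ?_
  · exact ⟨0, fun q => (map_zero q.p).le⟩
  · rintro x y ⟨C, hC⟩ ⟨D, hD⟩
    exact ⟨C + D, fun q => (map_add_le_add q.p _ _).trans (add_le_add (hC q) (hD q))⟩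
  · intro w c
    refine ⟨‖c‖, fun q => ?_⟩
    have hw : (show FreeStarAlg ι from MonoidAlgebra.single w c) = c • FreeStarAlg.word ι w := by
      refine Eq.trans ?_ (MonoidAlgebra.smul_single c w (1 : ℂ)).symm
      rw [smul_eq_mul, mul_one]
    rw [hw, map_smul_eq_mul]
    exact mul_le_of_le_one_right (norm_nonneg _) (hword q w)

theorem isometry_mem_cuntzToeplitzRelators {s : ℕ} (j : Fin s) :
    star (FreeStarAlg.gen j) * FreeStarAlg.gen j - 1 ∈ cuntzToeplitzRelators s :=
  ⟨(j, j), by simp⟩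

instance (s : ℕ) : AdmissibleRelators (cuntzToeplitzRelators s) :=
  admissible_of_isometries isometry_mem_cuntzToeplitzRelators

instance (s : ℕ) : AdmissibleRelators (cuntzRelators s) :=
  admissible_of_isometries fun j => Set.mem_insert_of_mem _ (isometry_mem_cuntzToeplitzRelators j)

/-- The Cuntz–Toeplitz algebra: the universal unital C⋆-algebra generated by `s` isometries with
pairwise orthogonal ranges. -/
abbrev CuntzToeplitzAlgebra (s : ℕ) : Type := UnivCStar (cuntzToeplitzRelators s)

/-- The Cuntz algebra `𝒪_s`: the universal unital C⋆-algebra with generators `u_0, …, u_{s-1}` and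
relations `u_j^* u_k = δ_{jk} 1`, `∑ u_j u_j^* = 1`. -/
abbrev CuntzAlgebra (s : ℕ) : Type := UnivCStar (cuntzRelators s)

/-- The canonical generators of the Cuntz–Toeplitz algebra. -/
noncomputable def cuntzToeplitzGen (s : ℕ) : Fin s → CuntzToeplitzAlgebra s :=
  UnivCStar.gen (cuntzToeplitzRelators s)

/-- The canonical generators of the Cuntz algebra. -/
noncomputable def cuntzGen (s : ℕ) : Fin s → CuntzAlgebra s :=
  UnivCStar.gen (cuntzRelators s)

theorem eval_cuntzToeplitzRelators_iff {s : ℕ} {B : Type*} [CStarAlgebra B] (v : Fin s → B) :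
    (∀ r ∈ cuntzToeplitzRelators s, FreeStarAlg.eval v r = 0) ↔
      ∀ j k, star (v j) * v k = if j = k then 1 else 0 := by
  simp only [cuntzToeplitzRelators, Set.forall_mem_range, Prod.forall]
  refine forall₂_congr fun j k => ?_
  rw [map_sub, map_mul, map_star, FreeStarAlg.eval_gen, FreeStarAlg.eval_gen, sub_eq_zero]
  split_ifs <;> simp

theorem eval_cuntzRelators_iff {s : ℕ} {B : Type*} [CStarAlgebra B] (v : Fin s → B) :
    (∀ r ∈ cuntzRelators s, FreeStarAlg.eval v r = 0) ↔
      (∀ j k, star (v j) * v k = if j = k then 1 else 0) ∧ ∑ j, v j * star (v j) = 1 := by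
  rw [← eval_cuntzToeplitzRelators_iff, cuntzRelators, Set.forall_mem_insert, and_comm]
  simp [map_sum, FreeStarAlg.eval_gen, sub_eq_zero, map_star]

/-! ### Compact operators -/

section Compact

variable {H : Type*} [NormedAddCommGroup H] [InnerProductSpace ℂ H] [CompleteSpace H]

theorem isCompactOperator_star {T : H →L[ℂ] H} (hT : IsCompactOperator T) :
    IsCompactOperator (ContinuousLinearMap.adjoint T) := by
  have hTT : IsCompactOperator (T ∘L (ContinuousLinearMap.adjoint T)) := hT.comp_clm (ContinuousLinearMap.adjoint T)
  have hc : IsCompact (closure ((T ∘L (ContinuousLinearMap.adjoint T)) '' Metric.ball 0 1)) :=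
    IsCompactOperator.isCompact_closure_image_ball (f := (T ∘L (ContinuousLinearMap.adjoint T)).toLinearMap) hTT 1
  have htb : TotallyBounded ((T ∘L (ContinuousLinearMap.adjoint T)) '' Metric.ball (0 : H) 1) :=
    hc.totallyBounded.subset subset_closure
  have key : ∀ x ∈ Metric.ball (0 : H) 1, ∀ y ∈ Metric.ball (0 : H) 1,
      ‖(ContinuousLinearMap.adjoint T) x - (ContinuousLinearMap.adjoint T) y‖ ^ 2 ≤ 2 * ‖(T ∘L (ContinuousLinearMap.adjoint T)) x - (T ∘L (ContinuousLinearMap.adjoint T)) y‖ := by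
    intro x hx y hy
    rw [← map_sub, ← map_sub]
    have hxy : ‖x - y‖ ≤ 2 := by
      have h1 : ‖x‖ < 1 := by simpa using hx
      have h2 : ‖y‖ < 1 := by simpa using hy
      linarith [norm_sub_le x y]
    have h3 : ‖(ContinuousLinearMap.adjoint T) (x - y)‖ ^ 2 = RCLike.re (inner ℂ ((T ∘L (ContinuousLinearMap.adjoint T)) (x - y)) (x - y)) := by
      rw [ContinuousLinearMap.comp_apply,
        ← ContinuousLinearMap.adjoint_inner_right, inner_self_eq_norm_sq]
    rw [h3]
    calc RCLike.re (inner ℂ ((T ∘L (ContinuousLinearMap.adjoint T)) (x - y)) (x - y))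
        ≤ ‖(T ∘L (ContinuousLinearMap.adjoint T)) (x - y)‖ * ‖x - y‖ := re_inner_le_norm _ _
      _ ≤ ‖(T ∘L (ContinuousLinearMap.adjoint T)) (x - y)‖ * 2 := by gcongr
      _ = 2 * ‖(T ∘L (ContinuousLinearMap.adjoint T)) (x - y)‖ := mul_comm _ _
  have htb' : TotallyBounded ((ContinuousLinearMap.adjoint T) '' Metric.ball (0 : H) 1) := by
    rw [Metric.totallyBounded_iff]
    intro ε hε
    obtain ⟨t, hts, htf, hcov⟩ :=
      Metric.finite_approx_of_totallyBounded htb (ε ^ 2 / 2) (by positivity)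
    have hc' : ∀ y ∈ t, ∃ x ∈ Metric.ball (0 : H) 1, (T ∘L (ContinuousLinearMap.adjoint T)) x = y := hts
    choose! c hcb hcy using hc'
    refine ⟨(fun y => (ContinuousLinearMap.adjoint T) (c y)) '' t, htf.image _, ?_⟩
    rintro _ ⟨x, hx, rfl⟩
    obtain ⟨y, hy, hxy⟩ := Set.mem_iUnion₂.1 (hcov ⟨x, hx, rfl⟩)
    refine Set.mem_iUnion₂.2 ⟨(ContinuousLinearMap.adjoint T) (c y), ⟨y, hy, rfl⟩, ?_⟩
    rw [Metric.mem_ball, dist_eq_norm] at hxy ⊢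
    have h := key x hx (c y) (hcb y hy)
    rw [hcy y hy] at h
    exact lt_of_pow_lt_pow_left₀ 2 hε.le (by linarith)
  rw [isCompactOperator_iff_exists_mem_nhds_isCompact_closure_image]
  exact ⟨Metric.ball 0 1, Metric.ball_mem_nhds 0 one_pos,
    htb'.closure.isCompact_of_isClosed isClosed_closure⟩

variable (H) in
/-- The C⋆-algebra `𝒦(H)` of compact operators on `H`. -/
def compactOperators : NonUnitalStarSubalgebra ℂ (H →L[ℂ] H) where
  carrier := {T | IsCompactOperator T}
  add_mem' hS hT := hS.add hT
  zero_mem' := isCompactOperator_zero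
  mul_mem' {_ T} hS _ := hS.comp_clm T
  smul_mem' c _ hT := hT.smul c
  star_mem' hT := isCompactOperator_star hT

end Compact

/-! ### The Hilbert space, the multiplication operators and the Bernoulli shift -/

/-- The space `ℤ_s` of `s`-adic integers `∑ x_j s^j`, as the space of digit sequences `(x_j)` with
the product topology. -/
abbrev SAdicInt (s : ℕ) : Type := ℕ → Fin s

/-- The digit sequence of a natural number. -/
def SAdicInt.ofNat (s : ℕ) [NeZero s] (x : ℕ) : SAdicInt s := fun j => Fin.ofNat s (x / s ^ j)

/-- The set `𝒱` of balls `(n, x)` in `ℤ_s`, where `0 ≤ x < s ^ n`. -/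
abbrev SAdicBall (s : ℕ) : Type := Σ n : ℕ, Fin (s ^ n)

/-- The Hilbert space `ℓ²(𝒱)`. -/
abbrev BallSpace (s : ℕ) : Type := lp (fun _ : SAdicBall s => ℂ) 2

/-- The canonical basis vectors of `ℓ²(𝒱)`. -/
noncomputable def basisVec {s : ℕ} (v : SAdicBall s) : BallSpace s := lp.single 2 v 1

theorem orthonormal_basisVec (s : ℕ) : Orthonormal ℂ (basisVec (s := s)) := by
  classical
  rw [orthonormal_iff_ite]
  intro v w
  rw [basisVec, basisVec, lp.inner_single_left, lp.single_apply]
  by_cases h : v = w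
  · subst h; simp
  · simp [h]

/-- The diagonal operator with bounded symbol `g`. -/
noncomputable def diagOp {s : ℕ} (g : SAdicBall s → ℂ) {C : ℝ} (hC : 0 ≤ C) (hg : ∀ v, ‖g v‖ ≤ C) :
    BallSpace s →L[ℂ] BallSpace s :=
  lp.mapCLM 2 (fun v => g v • ContinuousLinearMap.id ℂ ℂ) hC fun v => by
    rw [norm_smul, ContinuousLinearMap.norm_id, mul_one]
    exact hg v

theorem diagOp_basisVec {s : ℕ} (g : SAdicBall s → ℂ) {C : ℝ} (hC : 0 ≤ C)
    (hg : ∀ v, ‖g v‖ ≤ C) (v : SAdicBall s) :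
    diagOp g hC hg (basisVec v) = g v • basisVec v := by
  ext w
  by_cases h : w = v
  · subst h; simp [diagOp, basisVec]
  · simp [diagOp, basisVec, h]

/-- The multiplication operator `M_f E_(n,x) = f(x) E_(n,x)`. -/
noncomputable def mulOp {s : ℕ} [NeZero s] (f : C(SAdicInt s, ℂ)) :
    BallSpace s →L[ℂ] BallSpace s :=
  diagOp (fun v => f (SAdicInt.ofNat s v.2)) (norm_nonneg f) fun _ => f.norm_coe_le_norm _

/-- The unitary `𝒰_θ E_(n,x) = e^(2πinθ) E_(n,x)`. -/
noncomputable def gaugeUnitary (s : ℕ) (θ : ℝ) : BallSpace s →L[ℂ] BallSpace s :=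
  diagOp (fun v => Complex.exp ((2 * Real.pi * v.1 * θ : ℝ) * Complex.I)) zero_le_one
    fun _ => (Complex.norm_exp_ofReal_mul_I _).le

/-- The ball `(n + 1, s x + j)`. -/
def childBall {s : ℕ} (j : Fin s) (v : SAdicBall s) : SAdicBall s :=
  ⟨v.1 + 1, ⟨s * v.2 + j, by
    have h1 : (v.2 : ℕ) + 1 ≤ s ^ v.1 := v.2.2
    have h2 := j.2
    calc s * (v.2 : ℕ) + j < s * ((v.2 : ℕ) + 1) := by rw [mul_add]; omega
      _ ≤ s * s ^ v.1 := Nat.mul_le_mul_left s h1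
      _ = s ^ (v.1 + 1) := (pow_succ' s v.1).symm⟩⟩

theorem childBall_injective {s : ℕ} (j : Fin s) : Function.Injective (childBall j) := by
  rintro ⟨n, x⟩ ⟨m, y⟩ h
  obtain rfl : n = m := Nat.succ_injective (congrArg Sigma.fst h)
  have hs : 0 < s := j.pos
  have h2 : s * (x : ℕ) + j = s * (y : ℕ) + j := by
    have := eq_of_heq (Sigma.mk.inj h).2
    exact congrArg Fin.val this
  have h3 : (x : ℕ) = y := Nat.eq_of_mul_eq_mul_left hs (by omega)
  rw [Fin.ext h3]

/-- The isometry `E_(n,x) ↦ E_(n+1, s x + j)`. -/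
noncomputable def childOp {s : ℕ} (j : Fin s) : BallSpace s →L[ℂ] BallSpace s :=
  ((orthonormal_basisVec s).comp _ (childBall_injective j)).orthogonalFamily.linearIsometry
    |>.toContinuousLinearMap

theorem childOp_basisVec {s : ℕ} (j : Fin s) (v : SAdicBall s) :
    childOp j (basisVec v) = basisVec (childBall j v) := by
  refine (OrthogonalFamily.linearIsometry_apply_single
    ((orthonormal_basisVec s).comp _ (childBall_injective j)).orthogonalFamily (1 : ℂ)).trans ?_
  simp

/-- The Bernoulli shift `S E_(n,x) = (1/s) ∑_j E_(n+1, s x + j)`. -/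
noncomputable def bernoulliShift (s : ℕ) : BallSpace s →L[ℂ] BallSpace s :=
  (1 / s : ℂ) • ∑ j : Fin s, childOp j

theorem bernoulliShift_basisVec {s : ℕ} (v : SAdicBall s) :
    bernoulliShift s (basisVec v) = (1 / s : ℂ) • ∑ j : Fin s, basisVec (childBall j v) := by
  simp [bernoulliShift, childOp_basisVec]

/-! ### The Bernoulli shift algebra -/

/-- The Bernoulli shift algebra `A_S = C^*(S, M_f | f ∈ C(ℤ_s))`. It is unital since `M_1 = I`. -/
noncomputable def bernoulliAlgebra (s : ℕ) [NeZero s] :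
    StarSubalgebra ℂ (BallSpace s →L[ℂ] BallSpace s) :=
  (StarAlgebra.adjoin ℂ (insert (bernoulliShift s) (Set.range mulOp))).topologicalClosure

/-- The characteristic function of the ball of radius `1 / s` and center `j` in `ℤ_s`. -/
noncomputable def ballIndicator {s : ℕ} (j : Fin s) : C(SAdicInt s, ℂ) where
  toFun x := if x 0 = j then 1 else 0
  continuous_toFun := by
    have h : Continuous fun a : Fin s => if a = j then (1 : ℂ) else 0 := continuous_of_discreteTopology
    exact h.comp (continuous_apply 0)

/-- The element `S_j = s M_{χ_j} S` of `A_S`. -/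
noncomputable def bernoulliIsometry (s : ℕ) [NeZero s] (j : Fin s) : bernoulliAlgebra s :=
  ⟨(s : ℂ) • (mulOp (ballIndicator j) * bernoulliShift s), by
    have h : ∀ T ∈ insert (bernoulliShift s) (Set.range mulOp), T ∈ bernoulliAlgebra s := fun T hT =>
      StarSubalgebra.le_topologicalClosure _ (StarAlgebra.subset_adjoin ℂ _ hT)
    exact (bernoulliAlgebra s).smul_mem (mul_mem (h _ (Set.mem_insert_of_mem _ ⟨_, rfl⟩))
      (h _ (Set.mem_insert _ _))) _⟩

/-- The set `I_S = 𝒦(H)_inv` of gauge invariant compact operators. -/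
def invariantCompacts (s : ℕ) : Set (BallSpace s →L[ℂ] BallSpace s) :=
  {a | a ∈ compactOperators (BallSpace s) ∧
    ∀ θ : ℝ, gaugeUnitary s θ * a * star (gaugeUnitary s θ) = a}

/-- The C⋆-algebra `ℐ_S = C^*(a S^n | a ∈ I_S, n = 0, 1, …)`. -/
noncomputable def bernoulliIdeal (s : ℕ) :
    NonUnitalStarSubalgebra ℂ (BallSpace s →L[ℂ] BallSpace s) :=
  (NonUnitalStarAlgebra.adjoin ℂ
    {T | ∃ a ∈ invariantCompacts s, ∃ n : ℕ, T = a * bernoulliShift s ^ n}).topologicalClosure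

/-- The ideal of compact operators in `A_S`. -/
def compactIdeal (s : ℕ) [NeZero s] : Ideal (bernoulliAlgebra s) where
  carrier := {a | (a : BallSpace s →L[ℂ] BallSpace s) ∈ compactOperators (BallSpace s)}
  add_mem' ha hb := (compactOperators (BallSpace s)).add_mem' ha hb
  zero_mem' := isCompactOperator_zero
  smul_mem' c _ ha :=
    IsCompactOperator.clm_comp ha (c : BallSpace s →L[ℂ] BallSpace s)

instance (s : ℕ) [NeZero s] : (compactIdeal s).IsTwoSided where
  mul_mem_of_left {a} b ha :=
    have h : IsCompactOperator (a : BallSpace s →L[ℂ] BallSpace s) := ha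
    h.comp_clm (b : BallSpace s →L[ℂ] BallSpace s)

theorem star_mem_compactIdeal {s : ℕ} [NeZero s] {a : bernoulliAlgebra s}
    (ha : a ∈ compactIdeal s) : star a ∈ compactIdeal s :=
  (compactOperators (BallSpace s)).star_mem' ha

/-- The involution `[a]^* = [a^*]` of the quotient `A_S / 𝒦(H)`. -/
noncomputable instance (s : ℕ) [NeZero s] : StarRing (bernoulliAlgebra s ⧸ compactIdeal s) where
  star := Quotient.map' star fun a b h => by
    rw [Submodule.quotientRel_def] at h ⊢
    rw [← star_sub]
    exact star_mem_compactIdeal h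
  star_involutive := by
    rintro ⟨a⟩
    exact congrArg (Ideal.Quotient.mk (compactIdeal s)) (star_star a)
  star_mul := by
    rintro ⟨a⟩ ⟨b⟩
    exact congrArg (Ideal.Quotient.mk (compactIdeal s)) (star_mul a b)
  star_add := by
    rintro ⟨a⟩ ⟨b⟩
    exact congrArg (Ideal.Quotient.mk (compactIdeal s)) (star_add a b)

/-! The balls form a rooted tree in which `(n, x)` has the children `(n + 1, s x + j)`. So `ℓ²(𝒱)`
is the full Fock space on `s` letters, `S_j` is the creation operator `childOp j`, and the vacuum is
the root vector. Only the root is not a child, hence `1 - ∑ S_j S_j^*` is the rank one projection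
onto the vacuum (`sum_childOp_mul_star_add`).

The `S_j` generate `A_S`: the shift is `(1/s) ∑ S_j`, and the `M_f` follow by Stone–Weierstrass
(`mulOp_mem`). That the relations of the Cuntz–Toeplitz algebra determine its norm on the Fock space
is `norm_eval_le_of_vacuum`: for any isometries `v_j` with orthogonal ranges in a C⋆-algebra, the
positive maps `fejerMean` converge, on `*`-polynomials in the `S_j`, to the same polynomials in the
`v_j`. Positivity of `c² - x^* x` survives in the limit and gives the norm inequality.

For `ℐ_S`, the matrix unit from the root to a ball `v` of level `n` is `s^n E_{vv} S^n`, and the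
first column of matrix units generates `𝒦(H)` (`compactOperators_le`).

For the quotient, the canonical map to `𝒪_s` kills the vacuum projection, hence all of `𝒦(H)`.
Conversely the norm modulo `𝒦(H)` is a C⋆-seminorm that vanishes on the Cuntz relators, so the
universal norm of `𝒪_s` dominates it (`essentialNorm_fockRep_le`). Thus the kernel is exactly
`𝒦(H)`, and the same estimate supplies bounded lifts, which give surjectivity. -/

section Fejer

/-! ### Words in isometries and compressions to finitely many words -/

variable {s : ℕ}

/-- The product of the elements `v j` along a word. -/
def wordProd {B : Type*} [Monoid B] (v : Fin s → B) (w : List (Fin s)) : B := (w.map v).prod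

@[simp] theorem wordProd_nil {B : Type*} [Monoid B] (v : Fin s → B) : wordProd v [] = 1 := rfl

@[simp] theorem wordProd_cons {B : Type*} [Monoid B] (v : Fin s → B) (j : Fin s)
    (w : List (Fin s)) : wordProd v (j :: w) = v j * wordProd v w := by
  simp [wordProd]

@[simp] theorem wordProd_append {B : Type*} [Monoid B] (v : Fin s → B) (w w' : List (Fin s)) :
    wordProd v (w ++ w') = wordProd v w * wordProd v w' := by
  simp [wordProd]

/-- The words of length less than `m`. -/
def wordsBelow (s : ℕ) : ℕ → Finset (List (Fin s))
  | 0 => ∅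
  | m + 1 => insert [] ((Finset.univ ×ˢ wordsBelow s m).image fun p => p.1 :: p.2)

@[simp] theorem sum_wordsBelow_zero {M : Type*} [AddCommMonoid M] (f : List (Fin s) → M) :
    ∑ w ∈ wordsBelow s 0, f w = 0 := rfl

theorem sum_wordsBelow_succ {M : Type*} [AddCommMonoid M] (m : ℕ) (f : List (Fin s) → M) :
    ∑ w ∈ wordsBelow s (m + 1), f w = f [] + ∑ j, ∑ w ∈ wordsBelow s m, f (j :: w) := by
  rw [wordsBelow, Finset.sum_insert (by simp), Finset.sum_image (by simp), Finset.sum_product]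

variable {H : Type*} [NormedAddCommGroup H] [InnerProductSpace ℂ H]
  {B : Type*} [CStarAlgebra B]

/-- The compression `∑ ⟪e_a, T e_b⟫ v_a D v_b^*` of `T`, over words `a`, `b` of length less than `m`
and `n`, where `e_a = S_a Ω`. -/
noncomputable def wordCompression (S : Fin s → H →L[ℂ] H) (Ω : H) (v : Fin s → B) (D : B)
    (m n : ℕ) : (H →L[ℂ] H) →ₗ[ℂ] B where
  toFun T := ∑ a ∈ wordsBelow s m, ∑ b ∈ wordsBelow s n,
    inner ℂ (wordProd S a Ω) (T (wordProd S b Ω)) • (wordProd v a * D * star (wordProd v b))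
  map_add' T T' := by
    simp only [add_apply, inner_add_right, add_smul, Finset.sum_add_distrib]
  map_smul' c T := by
    simp only [smul_apply, inner_smul_right, mul_smul, Finset.smul_sum,
      RingHom.id_apply]

theorem wordCompression_apply (S : Fin s → H →L[ℂ] H) (Ω : H) (v : Fin s → B) (D : B)
    (m n : ℕ) (T : H →L[ℂ] H) : wordCompression S Ω v D m n T =
      ∑ a ∈ wordsBelow s m, ∑ b ∈ wordsBelow s n, inner ℂ (wordProd S a Ω) (T (wordProd S b Ω)) •
        (wordProd v a * D * star (wordProd v b)) := rfl

variable {S : Fin s → H →L[ℂ] H} {Ω : H} (v : Fin s → B) (D : B)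

theorem wordCompression_zero_left (n : ℕ) (T : H →L[ℂ] H) :
    wordCompression S Ω v D 0 n T = 0 := rfl

theorem wordCompression_zero_right (m : ℕ) (T : H →L[ℂ] H) :
    wordCompression S Ω v D m 0 T = 0 := by
  simp [wordCompression_apply]

variable [CompleteSpace H]

theorem star_apply_wordProd_cons (hS : ∀ j k, star (S j) * S k = if j = k then 1 else 0)
    (j k : Fin s) (w : List (Fin s)) :
    star (S j) (wordProd S (k :: w) Ω) = if j = k then wordProd S w Ω else 0 := by
  have h := congrArg (fun A : H →L[ℂ] H => A (wordProd S w Ω)) (hS j k)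
  rw [wordProd_cons]
  refine h.trans ?_
  split_ifs <;> rfl

theorem inner_apply_eq (T : H →L[ℂ] H) (x y : H) : inner ℂ x (T y) = inner ℂ (star T x) y :=
  (ContinuousLinearMap.adjoint_inner_left T y x).symm

/-- Move `S j` to the other side of the inner product: its adjoint kills `Ω` and every word that
does not begin with `j`, and strips the letter `j` from the others. This costs one unit of the
cut-off. The mirror statement below holds for the same reason. -/
theorem wordCompression_mul_left (hS : ∀ j k, star (S j) * S k = if j = k then 1 else 0)
    (hΩ : ∀ j, star (S j) Ω = 0) (m n : ℕ) (j : Fin s) (T : H →L[ℂ] H) :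
    wordCompression S Ω v D (m + 1) n (S j * T) = v j * wordCompression S Ω v D m n T := by
  simp only [wordCompression_apply, sum_wordsBelow_succ, mul_apply_eq_comp,
    inner_apply_eq (S j), star_apply_wordProd_cons hS, wordProd_nil,
    one_apply_eq_self, hΩ, inner_zero_left, zero_smul, Finset.sum_const_zero, zero_add,
    Finset.mul_sum]
  rw [Finset.sum_eq_single j (fun k _ hk => by simp [hk.symm]) (by simp)]
  simp [mul_assoc]

theorem wordCompression_mul_right (hS : ∀ j k, star (S j) * S k = if j = k then 1 else 0)
    (hΩ : ∀ j, star (S j) Ω = 0) (m n : ℕ) (j : Fin s) (T : H →L[ℂ] H) :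
    wordCompression S Ω v D m (n + 1) (T * star (S j)) =
      wordCompression S Ω v D m n T * star (v j) := by
  simp only [wordCompression_apply, sum_wordsBelow_succ, mul_apply_eq_comp,
    star_apply_wordProd_cons hS, wordProd_nil,
    one_apply_eq_self, hΩ, map_zero, inner_zero_right, zero_smul,
    zero_add, Finset.sum_mul]
  refine Finset.sum_congr rfl fun a _ => ?_
  rw [Finset.sum_eq_single j (fun k _ hk => by simp [hk.symm]) (by simp)]
  simp [mul_assoc]

/-- The map `X ↦ ∑ v_j X v_j^*`. -/
noncomputable def cuntzEndo (X : B) : B := ∑ j, v j * X * star (v j)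

/-- The empty word contributes `D`, mixed terms vanish because the `star (S j)` kill `Ω`, and pairs
of nonempty words survive only if their first letters agree. Iterating, with `σ = cuntzEndo v`, the
compression of `1` is the sum of `σ^k(D)` over `k < min m n`. -/
theorem wordCompression_one_succ (hS : ∀ j k, star (S j) * S k = if j = k then 1 else 0)
    (hΩ : ∀ j, star (S j) Ω = 0) (hn : ‖Ω‖ = 1) (m n : ℕ) :
    wordCompression S Ω v D (m + 1) (n + 1) 1 =
      D + cuntzEndo v (wordCompression S Ω v D m n 1) := by
  have h1 : ∀ (j : Fin s) (w : List (Fin s)), inner ℂ Ω (wordProd S (j :: w) Ω) = 0 := by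
    intro j w
    rw [wordProd_cons, mul_apply_eq_comp, inner_apply_eq, hΩ, inner_zero_left]
  have h2 : ∀ (j : Fin s) (w : List (Fin s)), inner ℂ (wordProd S (j :: w) Ω) Ω = 0 := by
    intro j w
    rw [← inner_conj_symm, h1, map_zero]
  have h3 : ∀ (j k : Fin s) (w w' : List (Fin s)),
      inner ℂ (wordProd S (j :: w) Ω) (wordProd S (k :: w') Ω) =
        if j = k then inner ℂ (wordProd S w Ω) (wordProd S w' Ω) else 0 := by
    intro j k w w'
    rw [wordProd_cons S k, mul_apply_eq_comp, inner_apply_eq,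
      star_apply_wordProd_cons hS]
    simp only [eq_comm (a := k)]
    split_ifs <;> simp
  have h4 : inner ℂ Ω Ω = (1 : ℂ) := by simp [inner_self_eq_norm_sq_to_K, hn]
  simp only [wordCompression_apply, sum_wordsBelow_succ, one_apply_eq_self, h3,
    wordProd_nil, h4, cuntzEndo]
  simp only [h1, h2]
  simp only [one_smul, one_mul, star_one, mul_one, zero_smul, Finset.sum_const_zero, add_zero,
    zero_add, Finset.mul_sum, Finset.sum_mul]
  congr 1
  refine Finset.sum_congr rfl fun j _ => Finset.sum_congr rfl fun a _ => ?_
  rw [Finset.sum_eq_single j (fun k _ hk => by simp [hk.symm]) (by simp)]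
  simp [mul_assoc]

/-- Peel off the letters of `u` and `w` one at a time. Truncated subtraction is harmless: once a
cut-off reaches `0`, both sides vanish. -/
theorem wordCompression_mul_word (hS : ∀ j k, star (S j) * S k = if j = k then 1 else 0)
    (hΩ : ∀ j, star (S j) Ω = 0) (u w : List (Fin s)) (N : ℕ) :
    wordCompression S Ω v D N N (wordProd S u * star (wordProd S w)) =
      wordProd v u * wordCompression S Ω v D (N - u.length) (N - w.length) 1 *
        star (wordProd v w) := by
  have hl : ∀ (u : List (Fin s)) (m n : ℕ) (T : H →L[ℂ] H),
      wordCompression S Ω v D m n (wordProd S u * T) =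
        wordProd v u * wordCompression S Ω v D (m - u.length) n T := by
    intro u
    induction u with
    | nil => simp
    | cons j u ih =>
      intro m n T
      cases m with
      | zero => simp [wordCompression_zero_left]
      | succ m =>
        rw [wordProd_cons, mul_assoc, wordCompression_mul_left v D hS hΩ, ih]
        simp [mul_assoc]
  have hr : ∀ (w : List (Fin s)) (m n : ℕ) (T : H →L[ℂ] H),
      wordCompression S Ω v D m n (T * star (wordProd S w)) =
        wordCompression S Ω v D m (n - w.length) T * star (wordProd v w) := by
    intro w
    induction w with
    | nil => simp
    | cons j w ih =>
      intro m n T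
      cases n with
      | zero => simp [wordCompression_zero_right]
      | succ n =>
        rw [wordProd_cons, star_mul, ← mul_assoc, wordCompression_mul_right v D hS hΩ, ih]
        simp [mul_assoc]
  rw [hl, ← one_mul (star (wordProd S w)), hr, mul_assoc]

end Fejer

/-! ### Fejér means: positivity, convergence and the norm inequality -/

section Fejer

variable {s : ℕ} {H : Type*} [NormedAddCommGroup H] [InnerProductSpace ℂ H]
  {B : Type*} [CStarAlgebra B]

/-- A Fejér mean of compressions. -/
noncomputable def fejerMean (S : Fin s → H →L[ℂ] H) (Ω : H) (v : Fin s → B) (N : ℕ) :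
    (H →L[ℂ] H) →ₗ[ℂ] B :=
  ((N : ℝ)⁻¹ : ℂ) • (∑ t ∈ Finset.range N,
      wordCompression S Ω v (1 - ∑ j, v j * star (v j)) (t + 1) (t + 1) +
    wordCompression S Ω v (∑ j, v j * star (v j)) N N)

variable {S : Fin s → H →L[ℂ] H} {Ω : H} {v : Fin s → B}

/-- For `T = z^* z` the coefficients are the inner products of the vectors `z e_a`, so they form a
Gram matrix and factor as `N^* N`. This turns the compression into a sum of terms `y_k D y_k^*`,
where `y_k` combines the `v_a` with coefficients `star (N k a)`. -/
theorem wordCompression_nonneg [CompleteSpace H] [PartialOrder B] [StarOrderedRing B]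
    {D : B} (hD : 0 ≤ D) (m : ℕ)
    {T : H →L[ℂ] H} (hT : 0 ≤ T) : 0 ≤ wordCompression S Ω v D m m T := by
  obtain ⟨z, rfl⟩ := CStarAlgebra.nonneg_iff_eq_star_mul_self.mp hT
  have hG := Matrix.posSemidef_gram ℂ fun a : wordsBelow s m => z (wordProd S a Ω)
  open scoped MatrixOrder Matrix.Norms.L2Operator in
  obtain ⟨N, hN⟩ := CStarAlgebra.nonneg_iff_eq_star_mul_self.mp hG.nonneg
  have hc : wordCompression S Ω v D m m (star z * z) =
      ∑ k, (∑ a : wordsBelow s m, star (N k a) • wordProd v (a : List (Fin s))) * D *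
        star (∑ a : wordsBelow s m, star (N k a) • wordProd v (a : List (Fin s))) := by
    have he : ∀ a b : wordsBelow s m, inner ℂ (wordProd S (a : List (Fin s)) Ω)
        ((star z * z) (wordProd S (b : List (Fin s)) Ω)) = ∑ k, star (N k a) * N k b := by
      intro a b
      rw [mul_apply_eq_comp, inner_apply_eq, star_star, ← Matrix.gram_apply (𝕜 := ℂ)
        (v := fun a : wordsBelow s m => z (wordProd S a Ω)), hN]
      simp [Matrix.mul_apply, Matrix.star_apply]
    rw [wordCompression_apply, ← Finset.sum_coe_sort]
    simp only [← Finset.sum_coe_sort (wordsBelow s m), he]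
    simp only [Finset.sum_smul, star_sum, star_smul, star_star, Finset.sum_mul, Finset.mul_sum,
      smul_mul_assoc, mul_smul_comm]
    rw [Finset.sum_comm]
    conv_rhs => rw [Finset.sum_comm]
    refine Finset.sum_congr rfl fun a _ => ?_
    rw [Finset.sum_comm]
    refine Finset.sum_congr rfl fun k _ => ?_
    rw [Finset.smul_sum]
    exact Finset.sum_congr rfl fun b _ => by rw [smul_smul, mul_comm]
  rw [hc]
  exact Finset.sum_nonneg fun k _ => star_right_conjugate_nonneg hD _

theorem isStarProjection_sum_mul_star (hv : ∀ j k, star (v j) * v k = if j = k then 1 else 0) :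
    IsStarProjection (∑ j, v j * star (v j)) := by
  refine ⟨?_, ?_⟩
  · rw [IsIdempotentElem, Finset.sum_mul_sum]
    refine Finset.sum_congr rfl fun j _ => ?_
    rw [Finset.sum_eq_single j]
    · rw [mul_assoc, ← mul_assoc (star (v j)), hv, if_pos rfl, one_mul]
    · intro k _ hk
      rw [mul_assoc, ← mul_assoc (star (v j)), hv, if_neg hk.symm, zero_mul, mul_zero]
    · simp
  · rw [IsSelfAdjoint, star_sum]
    simp

theorem fejerMean_nonneg [CompleteSpace H] [PartialOrder B] [StarOrderedRing B]
    (hv : ∀ j k, star (v j) * v k = if j = k then 1 else 0) (N : ℕ)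
    {T : H →L[ℂ] H} (hT : 0 ≤ T) : 0 ≤ fejerMean S Ω v N T := by
  have hQ := isStarProjection_sum_mul_star hv
  have h : 0 ≤ (∑ t ∈ Finset.range N,
        wordCompression S Ω v (1 - ∑ j, v j * star (v j)) (t + 1) (t + 1) +
      wordCompression S Ω v (∑ j, v j * star (v j)) N N) T := by
    rw [LinearMap.add_apply, LinearMap.sum_apply]
    exact add_nonneg (Finset.sum_nonneg fun t _ =>
      wordCompression_nonneg hQ.one_sub.nonneg _ hT) (wordCompression_nonneg hQ.nonneg _ hT)
  have h2 : (0 : ℝ) ≤ (N : ℝ)⁻¹ := by positivity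
  have := smul_nonneg h2 h
  rw [fejerMean, LinearMap.smul_apply, ← Complex.ofReal_inv]
  exact this

variable [CompleteSpace H]

theorem cuntzEndo_iterate_succ_one (v : Fin s → B) (k : ℕ) :
    cuntzEndo v ((cuntzEndo v)^[k] 1) = (cuntzEndo v)^[k + 1] 1 :=
  (Function.iterate_succ_apply' _ _ _).symm

/-- Since `σ(1) = ∑ v_j v_j^*`, the sum of `σ^k(1 - σ(1))` telescopes. The defect `σ^m(1)` need not
tend to `0` (it is `1` for Cuntz isometries), which is why the second weight `∑ v_j v_j^*` also
enters `fejerMean`. -/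
theorem wordCompression_one_sub (hS : ∀ j k, star (S j) * S k = if j = k then 1 else 0)
    (hΩ : ∀ j, star (S j) Ω = 0) (hn : ‖Ω‖ = 1) (m n : ℕ) :
    wordCompression S Ω v (1 - ∑ j, v j * star (v j)) m n 1 =
      1 - (cuntzEndo v)^[min m n] 1 := by
  have hsub : ∀ X Y : B, cuntzEndo v (X - Y) = cuntzEndo v X - cuntzEndo v Y := by
    intro X Y
    simp [cuntzEndo, mul_sub, sub_mul]
  have hone : cuntzEndo v 1 = ∑ j, v j * star (v j) := by simp [cuntzEndo]
  induction m generalizing n with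
  | zero => simp [wordCompression_zero_left]
  | succ m ih =>
    cases n with
    | zero => simp [wordCompression_zero_right]
    | succ n =>
      rw [wordCompression_one_succ _ _ hS hΩ hn, ih, hsub, cuntzEndo_iterate_succ_one, hone,
        Nat.succ_min_succ]
      abel

theorem wordCompression_one_proj (hS : ∀ j k, star (S j) * S k = if j = k then 1 else 0)
    (hΩ : ∀ j, star (S j) Ω = 0) (hn : ‖Ω‖ = 1) (m n : ℕ) :
    wordCompression S Ω v (∑ j, v j * star (v j)) m n 1 =
      ∑ k ∈ Finset.range (min m n), (cuntzEndo v)^[k + 1] 1 := by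
  have hsum : ∀ (t : Finset ℕ) (f : ℕ → B),
      cuntzEndo v (∑ k ∈ t, f k) = ∑ k ∈ t, cuntzEndo v (f k) := by
    intro t f
    simp only [cuntzEndo, Finset.mul_sum, Finset.sum_mul]
    exact Finset.sum_comm
  have hone : ∑ j, v j * star (v j) = (cuntzEndo v)^[0 + 1] 1 := by simp [cuntzEndo]
  induction m generalizing n with
  | zero => simp [wordCompression_zero_left]
  | succ m ih =>
    cases n with
    | zero => simp [wordCompression_zero_right]
    | succ n =>
      rw [wordCompression_one_succ _ _ hS hΩ hn, ih, hsum, Nat.succ_min_succ,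
        Finset.sum_range_succ', add_comm]
      congr 1
      exact Finset.sum_congr rfl fun k _ => cuntzEndo_iterate_succ_one v _

/-- The cancellation that dictates the two weights in `fejerMean`. Terms with `t + 1 ≤ d` vanish, as
truncated subtraction gives `g 0 = 1`. In the others `t + 1 - d` runs through `1, …, N - d`, and the
second sum removes exactly these values of `g`. -/
theorem sum_one_sub_add_sum (g : ℕ → B) (h0 : g 0 = 1) (d N : ℕ) :
    ∑ t ∈ Finset.range N, (1 - g (t + 1 - d)) + ∑ k ∈ Finset.range (N - d), g (k + 1) =
      ((N - d : ℕ) : B) := by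
  induction N with
  | zero => simp
  | succ N ih =>
    rw [Finset.sum_range_succ]
    rcases Nat.lt_or_ge N d with h | h
    · have h1 : N + 1 - d = 0 := by omega
      have h2 : N - d = 0 := by omega
      rw [h2] at ih
      rw [h1, h0, sub_self, add_zero]
      exact ih
    · have h1 : N + 1 - d = N - d + 1 := by omega
      rw [h1, Finset.sum_range_succ, Nat.cast_succ, ← ih]
      abel

/-- Pulling out `u` and `w` lowers the two cut-offs by different lengths, and the compression of `1`
sees only the smaller one: `min (N - |u|) (N - |w|) = N - max |u| |w|`. The iterates of `cuntzEndo`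
then cancel, leaving a Fejér coefficient that tends to `1`. -/
theorem fejerMean_word (hS : ∀ j k, star (S j) * S k = if j = k then 1 else 0)
    (hΩ : ∀ j, star (S j) Ω = 0) (hn : ‖Ω‖ = 1) (u w : List (Fin s)) (N : ℕ) :
    fejerMean S Ω v N (wordProd S u * star (wordProd S w)) =
      (((N : ℝ)⁻¹ * (N - max u.length w.length : ℕ) : ℝ) : ℂ) •
        (wordProd v u * star (wordProd v w)) := by
  rw [fejerMean, LinearMap.smul_apply, LinearMap.add_apply, LinearMap.sum_apply]
  simp only [wordCompression_mul_word v _ hS hΩ, wordCompression_one_sub hS hΩ hn,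
    wordCompression_one_proj hS hΩ hn, Nat.sub_min_sub_left]
  rw [← Finset.sum_mul, ← Finset.mul_sum, ← add_mul, ← mul_add,
    sum_one_sub_add_sum (fun k => (cuntzEndo v)^[k] 1) rfl]
  rw [mul_assoc, ← nsmul_eq_mul, mul_smul_comm, ← Nat.cast_smul_eq_nsmul ℂ, smul_smul]
  push_cast
  rfl

open Filter Topology in
theorem tendsto_fejerMean_word (hS : ∀ j k, star (S j) * S k = if j = k then 1 else 0)
    (hΩ : ∀ j, star (S j) Ω = 0) (hn : ‖Ω‖ = 1) (u w : List (Fin s)) :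
    Tendsto (fun N => fejerMean S Ω v N (wordProd S u * star (wordProd S w))) atTop
      (𝓝 (wordProd v u * star (wordProd v w))) := by
  simp only [fejerMean_word hS hΩ hn]
  set d := max u.length w.length
  have h : Tendsto (fun N : ℕ => (N : ℝ)⁻¹ * (N - d : ℕ)) atTop (𝓝 1) := by
    have h1 : Tendsto (fun N : ℕ => 1 - (d : ℝ) / N) atTop (𝓝 (1 - 0)) :=
      tendsto_const_nhds.sub (tendsto_const_div_atTop_nhds_zero_nat (d : ℝ))
    rw [sub_zero] at h1
    refine h1.congr' ?_
    filter_upwards [eventually_ge_atTop (d + 1)] with N hN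
    have : (N : ℝ) ≠ 0 := by
      have : N ≠ 0 := by omega
      exact_mod_cast this
    rw [Nat.cast_sub (by omega)]
    field_simp
  have h2 := ((Complex.continuous_ofReal.tendsto 1).comp h).smul_const
    (wordProd v u * star (wordProd v w))
  simpa using h2

/-- Every word in isometries with orthogonal ranges and their adjoints vanishes or reduces to the
form `v_u v_w^*`, in a way that only depends on the word. -/
theorem eval_word_reduce {B' : Type*} [CStarAlgebra B'] {v' : Fin s → B'}
    (hv : ∀ j k, star (v j) * v k = if j = k then 1 else 0)
    (hv' : ∀ j k, star (v' j) * v' k = if j = k then 1 else 0)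
    (a : FreeMonoid (Fin s ⊕ Fin s)) :
    (FreeStarAlg.eval v (FreeStarAlg.word _ a) = 0 ∧
      FreeStarAlg.eval v' (FreeStarAlg.word _ a) = 0) ∨
    ∃ u w, FreeStarAlg.eval v (FreeStarAlg.word _ a) = wordProd v u * star (wordProd v w) ∧
      FreeStarAlg.eval v' (FreeStarAlg.word _ a) = wordProd v' u * star (wordProd v' w) := by
  induction a using FreeMonoid.inductionOn' with
  | one => exact Or.inr ⟨[], [], by simp, by simp⟩
  | of_mul l a ih =>
    rw [map_mul, map_mul, map_mul]
    rcases ih with ⟨h, h'⟩ | ⟨u, w, h, h'⟩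
    · exact Or.inl ⟨by rw [h, mul_zero], by rw [h', mul_zero]⟩
    rw [h, h']
    rcases l with j | j
    · have hl : FreeStarAlg.word (Fin s) (FreeMonoid.of (Sum.inl j)) = FreeStarAlg.gen j := rfl
      rw [hl, FreeStarAlg.eval_gen, FreeStarAlg.eval_gen]
      exact Or.inr ⟨j :: u, w, by simp [mul_assoc], by simp [mul_assoc]⟩
    · have hl : FreeStarAlg.word (Fin s) (FreeMonoid.of (Sum.inr j)) = star (FreeStarAlg.gen j) :=
        (FreeStarAlg.star_letter (Sum.inl j)).symm
      rw [hl, map_star, map_star, FreeStarAlg.eval_gen, FreeStarAlg.eval_gen]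
      rcases u with _ | ⟨k, u⟩
      -- `v_j^* v_w^* = (v_w v_j)^*`, so the letter goes to the end of `w`.
      · exact Or.inr ⟨[], w ++ [j], by simp, by simp⟩
      · by_cases hjk : j = k
        · refine Or.inr ⟨u, w, ?_, ?_⟩
          · rw [wordProd_cons, mul_assoc, ← mul_assoc (star (v j)), hv, if_pos hjk, one_mul]
          · rw [wordProd_cons, mul_assoc, ← mul_assoc (star (v' j)), hv', if_pos hjk, one_mul]
        · refine Or.inl ⟨?_, ?_⟩
          · rw [wordProd_cons, mul_assoc, ← mul_assoc (star (v j)), hv, if_neg hjk, zero_mul]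
          · rw [wordProd_cons, mul_assoc, ← mul_assoc (star (v' j)), hv', if_neg hjk, zero_mul]

-- By linearity only words matter, and `eval_word_reduce` brings a word to the same normal form for
-- `S` and for `v`.
open Filter Topology in
theorem tendsto_fejerMean_eval (hS : ∀ j k, star (S j) * S k = if j = k then 1 else 0)
    (hΩ : ∀ j, star (S j) Ω = 0) (hn : ‖Ω‖ = 1)
    (hv : ∀ j k, star (v j) * v k = if j = k then 1 else 0) (x : FreeStarAlg (Fin s)) :
    Tendsto (fun N => fejerMean S Ω v N (FreeStarAlg.eval S x)) atTop
      (𝓝 (FreeStarAlg.eval v x)) := by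
  refine MonoidAlgebra.induction_linear
    (motive := fun x : MonoidAlgebra ℂ (FreeMonoid (Fin s ⊕ Fin s)) =>
      Tendsto (fun N => fejerMean S Ω v N (FreeStarAlg.eval S (show FreeStarAlg (Fin s) from x)))
        atTop (𝓝 (FreeStarAlg.eval v (show FreeStarAlg (Fin s) from x)))) x ?_ ?_ ?_
  · have h1 : FreeStarAlg.eval S 0 = 0 := map_zero _
    have h2 : FreeStarAlg.eval v 0 = 0 := map_zero _
    change Tendsto (fun N => fejerMean S Ω v N (FreeStarAlg.eval S 0)) atTop
      (𝓝 (FreeStarAlg.eval v 0))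
    rw [h1, h2]
    simp
  · intro x y hx hy
    have h1 := map_add (FreeStarAlg.eval S) x y
    have h2 := map_add (FreeStarAlg.eval v) x y
    refine (hx.add hy).congr' ?_ |>.trans ?_
    · exact Eventually.of_forall fun N =>
        (map_add (fejerMean S Ω v N) _ _).symm.trans (congrArg _ h1.symm)
    · exact (congrArg 𝓝 h2.symm).le
  · intro a c
    have hw : (show FreeStarAlg (Fin s) from MonoidAlgebra.single a c) =
        c • FreeStarAlg.word (Fin s) a := by
      refine Eq.trans ?_ (MonoidAlgebra.smul_single c a (1 : ℂ)).symm
      rw [smul_eq_mul, mul_one]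
    rw [hw]
    simp only [map_smul]
    refine Tendsto.const_smul ?_ c
    rcases eval_word_reduce hS hv a with ⟨h, h'⟩ | ⟨u, w, h, h'⟩
    · rw [h, h']
      simp
    · rw [h, h']
      exact tendsto_fejerMean_word hS hΩ hn u w

/-- The Fock representation dominates every family of isometries with orthogonal ranges. -/
theorem norm_eval_le_of_vacuum (hS : ∀ j k, star (S j) * S k = if j = k then 1 else 0)
    (hΩ : ∀ j, star (S j) Ω = 0) (hn : ‖Ω‖ = 1)
    (hv : ∀ j k, star (v j) * v k = if j = k then 1 else 0) (x : FreeStarAlg (Fin s)) :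
    ‖FreeStarAlg.eval v x‖ ≤ ‖FreeStarAlg.eval S x‖ := by
  let _ := CStarAlgebra.spectralOrder B
  have := CStarAlgebra.spectralOrderedRing B
  set c := ‖FreeStarAlg.eval S x‖
  have h0 : 0 ≤ algebraMap ℝ (H →L[ℂ] H) (c ^ 2) - FreeStarAlg.eval S (star x * x) := by
    rw [sub_nonneg, map_mul, map_star]
    exact CStarAlgebra.star_mul_le_algebraMap_norm_sq
  -- Both differences are values of one `*`-polynomial, so the Fejér means of the first converge to
  -- the second. They are positive and the positive cone of `B` is closed.
  have e : algebraMap ℝ (H →L[ℂ] H) (c ^ 2) - FreeStarAlg.eval S (star x * x) =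
      FreeStarAlg.eval S (algebraMap ℂ _ ((c ^ 2 : ℝ) : ℂ) - star x * x) := by
    rw [map_sub, AlgHomClass.commutes]
    rfl
  have e' : FreeStarAlg.eval v (algebraMap ℂ _ ((c ^ 2 : ℝ) : ℂ) - star x * x) =
      algebraMap ℝ B (c ^ 2) - star (FreeStarAlg.eval v x) * FreeStarAlg.eval v x := by
    rw [map_sub, AlgHomClass.commutes, map_mul, map_star]
    rfl
  rw [e] at h0
  have h1 := CStarAlgebra.isClosed_nonneg.mem_of_tendsto
    (tendsto_fejerMean_eval hS hΩ hn hv (algebraMap ℂ _ ((c ^ 2 : ℝ) : ℂ) - star x * x))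
    (Filter.Eventually.of_forall fun N => fejerMean_nonneg hv N h0)
  rw [Set.mem_ofPred_eq, e', sub_nonneg] at h1
  have h2 := (CStarAlgebra.norm_le_iff_le_algebraMap _ (by positivity)
    (star_mul_self_nonneg _)).2 h1
  rw [CStarRing.norm_star_mul_self, ← sq] at h2
  exact le_of_sq_le_sq h2 (norm_nonneg _)

end Fejer

/-! ### Approximation of compact operators by finite rank -/

section CompactApproximation

open InnerProductSpace

variable {H : Type*} [NormedAddCommGroup H] [InnerProductSpace ℂ H]

theorem isCompactOperator_rankOne (x y : H) : IsCompactOperator (rankOne ℂ x y) := by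
  have h : IsCompactOperator (innerSL ℂ y : H →L[ℂ] ℂ) :=
    isCompactOperator_of_locallyCompactSpace_dom (innerSL ℂ y)
  rw [rankOne_def']
  exact h.clm_comp (ContinuousLinearMap.toSpanSingleton ℂ x)

theorem isClosed_compactOperators [CompleteSpace H] :
    IsClosed (compactOperators H : Set (H →L[ℂ] H)) :=
  isClosed_setOfPred_isCompactOperator

/-- A compact operator is a norm limit of its compressions to finite-dimensional subspaces. -/
theorem exists_norm_sub_starProjection_mul_le {T : H →L[ℂ] H} (hT : IsCompactOperator T) {ε : ℝ}
    (hε : 0 < ε) : ∃ (V : Submodule ℂ H) (_ : FiniteDimensional ℂ V),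
      ‖T - V.starProjection * T‖ ≤ ε := by
  have htb : TotallyBounded (T '' Metric.closedBall (0 : H) 1) :=
    (IsCompactOperator.isCompact_closure_image_closedBall (f := T.toLinearMap) hT
      1).totallyBounded.subset subset_closure
  obtain ⟨t, htf, hcov⟩ := Metric.totallyBounded_iff.1 htb ε hε
  have hfd : FiniteDimensional ℂ (Submodule.span ℂ t) := FiniteDimensional.span_of_finite ℂ htf
  -- `t` is a finite `ε`-net for the image of the unit ball. The projection onto its span realizes
  -- the distance to the span, which is at most the distance to the nearby net point.
  refine ⟨Submodule.span ℂ t, hfd, ContinuousLinearMap.opNorm_le_of_unit_norm hε.le fun x hx => ?_⟩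
  obtain ⟨y, hy, hxy⟩ := Set.mem_iUnion₂.1 (hcov ⟨x, by simp [hx], rfl⟩)
  rw [Metric.mem_ball, dist_eq_norm] at hxy
  rw [sub_apply, mul_apply_eq_comp, Submodule.starProjection_minimal]
  exact (ciInf_le ⟨0, by rintro _ ⟨z, rfl⟩; exact norm_nonneg _⟩
    (⟨y, Submodule.subset_span hy⟩ : Submodule.span ℂ t)).trans hxy.le

variable [CompleteSpace H]

/-- A closed subspace that contains the operators of rank one contains the compact operators. -/
theorem mem_of_isCompactOperator {J : Submodule ℂ (H →L[ℂ] H)}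
    (hJ : IsClosed (J : Set (H →L[ℂ] H))) (h : ∀ x y, rankOne ℂ x y ∈ J) {T : H →L[ℂ] H}
    (hT : IsCompactOperator T) : T ∈ J := by
  refine hJ.closure_subset (Metric.mem_closure_iff.2 fun ε hε => ?_)
  obtain ⟨V, hV, hVT⟩ := exists_norm_sub_starProjection_mul_le hT (half_pos hε)
  refine ⟨V.starProjection * T, ?_, ?_⟩
  · rw [(stdOrthonormalBasis ℂ V).starProjection_eq_sum_rankOne, Finset.sum_mul]
    exact J.sum_mem fun i _ => by
      rw [ContinuousLinearMap.mul_def, rankOne_comp]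
      exact h _ _
  · rw [dist_eq_norm]
    exact hVT.trans_lt (half_lt_self hε)

end CompactApproximation

/-! ### The norm modulo compact operators is a C⋆-seminorm -/

section EssentialNorm

variable {H : Type*} [NormedAddCommGroup H] [InnerProductSpace ℂ H] [CompleteSpace H]

variable (H) in
/-- The seminorm `T ↦ ‖T + 𝒦(H)‖`. -/
noncomputable def essentialNorm : Seminorm ℂ (H →L[ℂ] H) :=
  (normSeminorm ℂ ((H →L[ℂ] H) ⧸ (compactOperators H).toSubmodule)).comp
    (compactOperators H).toSubmodule.mkQ

theorem essentialNorm_eq_infDist (T : H →L[ℂ] H) :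
    essentialNorm H T = Metric.infDist T (compactOperators H) :=
  QuotientAddGroup.norm_mk (S := (compactOperators H).toSubmodule.toAddSubgroup) T

theorem essentialNorm_le (T : H →L[ℂ] H) {K : H →L[ℂ] H} (hK : K ∈ compactOperators H) :
    essentialNorm H T ≤ ‖T - K‖ := by
  rw [essentialNorm_eq_infDist, ← dist_eq_norm]
  exact Metric.infDist_le_dist_of_mem hK

theorem exists_norm_sub_lt_of_essentialNorm (T : H →L[ℂ] H) {r : ℝ} (h : essentialNorm H T < r) :
    ∃ K ∈ compactOperators H, ‖T - K‖ < r := by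
  have hne : (compactOperators H : Set (H →L[ℂ] H)).Nonempty := ⟨0, (compactOperators H).zero_mem⟩
  rw [essentialNorm_eq_infDist, Metric.infDist_lt_iff hne] at h
  simp only [dist_eq_norm] at h
  exact h

theorem mul_mem_compactOperators_left (T : H →L[ℂ] H) {K : H →L[ℂ] H}
    (hK : K ∈ compactOperators H) : T * K ∈ compactOperators H :=
  IsCompactOperator.clm_comp (f := K) hK T

theorem mul_mem_compactOperators_right (T : H →L[ℂ] H) {K : H →L[ℂ] H}
    (hK : K ∈ compactOperators H) : K * T ∈ compactOperators H :=
  IsCompactOperator.comp_clm (f := K) hK T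

theorem essentialNorm_eq_zero_iff {T : H →L[ℂ] H} :
    essentialNorm H T = 0 ↔ T ∈ compactOperators H := by
  have hne : (compactOperators H : Set (H →L[ℂ] H)).Nonempty := ⟨0, (compactOperators H).zero_mem⟩
  rw [essentialNorm_eq_infDist]
  exact (isClosed_compactOperators.mem_iff_infDist_zero hne).symm

theorem continuous_essentialNorm : Continuous (essentialNorm H) := by
  have h : (essentialNorm H : (H →L[ℂ] H) → ℝ) =
      fun T => Metric.infDist T (compactOperators H : Set (H →L[ℂ] H)) :=
    funext essentialNorm_eq_infDist
  rw [h]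
  exact Metric.continuous_infDist_pt _

theorem essentialNorm_mul_le (S T : H →L[ℂ] H) :
    essentialNorm H (S * T) ≤ essentialNorm H S * essentialNorm H T := by
  refine le_of_forall_gt_imp_ge_of_dense fun r hr => ?_
  obtain ⟨a, ha, b, hb, hab⟩ : ∃ a, essentialNorm H S < a ∧ ∃ b, essentialNorm H T < b ∧
      a * b < r := by
    have hc : Filter.Tendsto (fun δ : ℝ => (essentialNorm H S + δ) * (essentialNorm H T + δ))
        (nhdsWithin 0 (Set.Ioi 0)) (nhds (essentialNorm H S * essentialNorm H T)) := by
      have : Continuous fun δ : ℝ => (essentialNorm H S + δ) * (essentialNorm H T + δ) := by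
        fun_prop
      simpa using (this.tendsto 0).mono_left nhdsWithin_le_nhds
    obtain ⟨δ, hδ, hδ0⟩ := ((hc.eventually_lt_const hr).and self_mem_nhdsWithin).exists
    have hδ0 : 0 < δ := hδ0
    exact ⟨_, by linarith, _, by linarith, hδ⟩
  obtain ⟨K, hK, hSK⟩ := exists_norm_sub_lt_of_essentialNorm S ha
  obtain ⟨L, hL, hTL⟩ := exists_norm_sub_lt_of_essentialNorm T hb
  -- This is the compact part of `S * T` in the expansion of `(S - K) * (T - L)`.
  have hmem : S * L + K * (T - L) ∈ compactOperators H :=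
    add_mem (mul_mem_compactOperators_left S hL) (mul_mem_compactOperators_right _ hK)
  calc essentialNorm H (S * T) ≤ ‖S * T - (S * L + K * (T - L))‖ := essentialNorm_le _ hmem
    _ = ‖(S - K) * (T - L)‖ := by congr 1; noncomm_ring
    _ ≤ ‖S - K‖ * ‖T - L‖ := norm_mul_le _ _
    _ ≤ a * b := mul_le_mul hSK.le hTL.le (norm_nonneg _) ((norm_nonneg _).trans hSK.le)
    _ ≤ r := hab.le

theorem essentialNorm_star_le (T : H →L[ℂ] H) : essentialNorm H (star T) ≤ essentialNorm H T := by
  refine le_of_forall_gt_imp_ge_of_dense fun r hr => ?_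
  obtain ⟨K, hK, hTK⟩ := exists_norm_sub_lt_of_essentialNorm T hr
  refine (essentialNorm_le _ (star_mem hK)).trans ?_
  rw [← star_sub, norm_star]
  exact hTK.le

/-- For the inequality `≥`, take a nearly optimal compact `K` for `T^* T` and a finite rank
projection `P` with `K (1 - P)` small. Then `T (1 - P)` is a compact perturbation of `T`, and the
C⋆-identity bounds its squared norm by `‖T^* T - K‖ + ‖K (1 - P)‖`. -/
theorem essentialNorm_star_mul_self (T : H →L[ℂ] H) :
    essentialNorm H (star T * T) = essentialNorm H T ^ 2 := by
  refine le_antisymm ?_ ?_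
  · rw [sq]
    exact (essentialNorm_mul_le _ _).trans
      (mul_le_mul_of_nonneg_right (essentialNorm_star_le T) (apply_nonneg _ _))
  refine le_of_forall_pos_le_add fun ε hε => ?_
  obtain ⟨K, hK, hTK⟩ := exists_norm_sub_lt_of_essentialNorm (star T * T)
    (lt_add_of_pos_right _ (half_pos hε))
  -- The approximation compresses on the left, so it is applied to `star K` to get a compression of
  -- `K` on the right.
  obtain ⟨V, hV, hVK⟩ := exists_norm_sub_starProjection_mul_le
    (T := star K) (star_mem hK) (half_pos hε)
  set P := V.starProjection
  have hP : star P = P := (isStarProjection_starProjection (U := V)).isSelfAdjoint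
  have hKP : ‖K * (1 - P)‖ ≤ ε / 2 := by
    rw [← norm_star, star_mul, star_sub, star_one, hP, sub_mul, one_mul]
    exact hVK
  have hP1 : ‖1 - P‖ ≤ 1 := (isStarProjection_starProjection (U := V)).one_sub.norm_le
  have hPc : P ∈ compactOperators H := by
    have h : IsCompactOperator V.subtypeL :=
      have := FiniteDimensional.proper ℂ V
      isCompactOperator_of_locallyCompactSpace_rng V.subtypeL
    exact h.comp_clm V.orthogonalProjectionOnto
  have h1 : essentialNorm H T ≤ ‖T * (1 - P)‖ := by
    rw [mul_sub, mul_one]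
    exact essentialNorm_le T (mul_mem_compactOperators_left T hPc)
  calc essentialNorm H T ^ 2 ≤ ‖T * (1 - P)‖ ^ 2 := by gcongr
    _ = ‖(1 - P) * ((star T * T - K) * (1 - P) + K * (1 - P))‖ := by
      rw [sq, ← CStarRing.norm_star_mul_self, star_mul, star_sub, star_one, hP]
      congr 1
      noncomm_ring
    _ ≤ ‖1 - P‖ * (‖star T * T - K‖ * ‖1 - P‖ + ‖K * (1 - P)‖) :=
      (norm_mul_le _ _).trans (mul_le_mul_of_nonneg_left
        ((norm_add_le _ _).trans (add_le_add_left (norm_mul_le _ _) _)) (norm_nonneg _))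
    _ ≤ 1 * ((essentialNorm H (star T * T) + ε / 2) * 1 + ε / 2) := by gcongr
    _ = essentialNorm H (star T * T) + ε := by ring

end EssentialNorm

/-! ### The tree of balls, its creation operators and matrix units -/

open InnerProductSpace

section BallSpace

variable {s : ℕ}

theorem ballSpace_ext {F : Type*} [NormedAddCommGroup F] [NormedSpace ℂ F]
    {A B : BallSpace s →L[ℂ] F} (h : ∀ v, A (basisVec v) = B (basisVec v)) : A = B := by
  refine lp.ext_continuousLinearMap (ENNReal.ofNat_ne_top (n := nat_lit 2)) fun v => ?_
  ext
  exact h v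

theorem ballSpace_mem_of_isClosed {N : Submodule ℂ (BallSpace s)}
    (hN : IsClosed (N : Set (BallSpace s))) (h : ∀ v, basisVec v ∈ N) (x : BallSpace s) :
    x ∈ N := by
  classical
  refine hN.mem_of_tendsto (lp.hasSum_single (ENNReal.ofNat_ne_top (n := nat_lit 2)) x)
    (Filter.Eventually.of_forall fun t => N.sum_mem fun v _ => ?_)
  have : lp.single 2 v (x v) = x v • basisVec v := by
    rw [basisVec, ← lp.single_smul, smul_eq_mul, mul_one]
  rw [this]
  exact N.smul_mem _ (h v)

theorem inner_basisVec (v w : SAdicBall s) :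
    inner ℂ (basisVec v) (basisVec w) = if v = w then (1 : ℂ) else 0 := by
  classical
  exact (orthonormal_iff_ite.1 (orthonormal_basisVec s)) v w

theorem ballSpace_vec_ext {x y : BallSpace s}
    (h : ∀ v, inner ℂ (basisVec v) x = inner ℂ (basisVec v) y) : x = y := by
  ext v
  simpa [basisVec, lp.inner_single_left] using h v

/-- The root ball `(0, 0)`. -/
def rootBall (s : ℕ) : SAdicBall s := ⟨0, ⟨0, by simp⟩⟩

theorem childBall_ne_rootBall (j : Fin s) (v : SAdicBall s) : childBall j v ≠ rootBall s :=
  fun h => Nat.succ_ne_zero v.1 (congrArg Sigma.fst h)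

/-- The residue of `s x + j` modulo `s` recovers `j`. This makes the ranges of the `childOp j`
orthogonal. -/
theorem childBall_eq_childBall_iff (j k : Fin s) (v w : SAdicBall s) :
    childBall j v = childBall k w ↔ j = k ∧ v = w := by
  refine ⟨fun h => ?_, by rintro ⟨rfl, rfl⟩; rfl⟩
  suffices hjk : j = k by
    subst hjk
    exact ⟨rfl, childBall_injective j h⟩
  obtain ⟨n, x⟩ := v
  obtain ⟨m, y⟩ := w
  obtain rfl : n = m := Nat.succ_injective (congrArg Sigma.fst h)
  have h2 : s * (x : ℕ) + j = s * (y : ℕ) + k := congrArg Fin.val (eq_of_heq (Sigma.mk.inj h).2)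
  have h3 := congrArg (· % s) h2
  simp only [Nat.mul_add_mod, Nat.mod_eq_of_lt j.2, Nat.mod_eq_of_lt k.2] at h3
  exact Fin.ext h3

theorem eq_childBall_of_level_succ {n : ℕ} (x : Fin (s ^ (n + 1))) :
    ∃ (j : Fin s) (w : SAdicBall s), w.1 = n ∧ (⟨n + 1, x⟩ : SAdicBall s) = childBall j w := by
  have hx : (x : ℕ) < s ^ n * s := by rw [← pow_succ]; exact x.2
  have hs : 0 < s := Nat.pos_of_ne_zero fun h => by simp [h] at hx
  refine ⟨⟨x % s, Nat.mod_lt _ hs⟩, ⟨n, ⟨x / s, Nat.div_lt_of_lt_mul (by rwa [mul_comm])⟩⟩, rfl, ?_⟩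
  rw [childBall]
  congr 1
  exact Fin.ext (Nat.div_add_mod _ _).symm

theorem eq_rootBall_of_level_zero (x : Fin (s ^ 0)) : (⟨0, x⟩ : SAdicBall s) = rootBall s := by
  rw [rootBall]
  congr 1
  have := x.2
  exact Fin.ext (by simpa using this)

/-- Every ball is obtained from the root by passing to children. -/
theorem sAdicBall_induction {P : SAdicBall s → Prop} (root : P (rootBall s))
    (child : ∀ j v, P v → P (childBall j v)) (v : SAdicBall s) : P v := by
  obtain ⟨n, x⟩ := v
  induction n with
  | zero => rwa [eq_rootBall_of_level_zero]
  | succ n ih =>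
    obtain ⟨j, ⟨m, w⟩, rfl, hw⟩ := eq_childBall_of_level_succ x
    rw [hw]
    exact child j _ (ih w)

theorem star_childOp_childBall (j k : Fin s) (v : SAdicBall s) :
    star (childOp j) (basisVec (childBall k v)) = if j = k then basisVec v else 0 := by
  refine ballSpace_vec_ext fun w => ?_
  rw [inner_apply_eq, star_star, childOp_basisVec, inner_basisVec]
  simp only [childBall_eq_childBall_iff]
  by_cases h : j = k
  · simp [h, inner_basisVec]
  · simp [h]

theorem star_childOp_rootBall (j : Fin s) : star (childOp j) (basisVec (rootBall s)) = 0 := by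
  refine ballSpace_vec_ext fun w => ?_
  rw [inner_apply_eq, star_star, childOp_basisVec, inner_basisVec,
    if_neg (childBall_ne_rootBall j w), inner_zero_right]

theorem star_childOp_mul_childOp (j k : Fin s) :
    star (childOp j) * childOp k = if j = k then 1 else 0 := by
  refine ballSpace_ext fun v => ?_
  rw [mul_apply_eq_comp, childOp_basisVec, star_childOp_childBall]
  split_ifs <;> simp

theorem norm_basisVec (v : SAdicBall s) : ‖basisVec v‖ = 1 := (orthonormal_basisVec s).1 v

/-- The rank one operator `x ↦ ⟪E_w, x⟫ E_v`. -/
noncomputable def matrixUnit (v w : SAdicBall s) : BallSpace s →L[ℂ] BallSpace s :=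
  rankOne ℂ (basisVec v) (basisVec w)

theorem matrixUnit_apply (v w u : SAdicBall s) :
    matrixUnit v w (basisVec u) = if w = u then basisVec v else 0 := by
  rw [matrixUnit, rankOne_apply, inner_basisVec]
  split_ifs <;> simp

theorem star_matrixUnit (v w : SAdicBall s) : star (matrixUnit v w) = matrixUnit w v :=
  adjoint_rankOne _ _

theorem mul_matrixUnit (T : BallSpace s →L[ℂ] BallSpace s) (v w : SAdicBall s) :
    T * matrixUnit v w = rankOne ℂ (T (basisVec v)) (basisVec w) :=
  comp_rankOne _ _ _

theorem matrixUnit_mul (T : BallSpace s →L[ℂ] BallSpace s) (v w : SAdicBall s) :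
    matrixUnit v w * T = rankOne ℂ (basisVec v) (star T (basisVec w)) :=
  rankOne_comp _ _ _

theorem matrixUnit_mul_matrixUnit (u v w : SAdicBall s) :
    matrixUnit u v * matrixUnit v w = matrixUnit u w := by
  rw [mul_matrixUnit, matrixUnit_apply, if_pos rfl, matrixUnit]

theorem matrixUnit_mem_compactOperators (v w : SAdicBall s) :
    matrixUnit v w ∈ compactOperators (BallSpace s) :=
  isCompactOperator_rankOne _ _

theorem childOp_mul_matrixUnit (j : Fin s) (v w : SAdicBall s) :
    childOp j * matrixUnit v w = matrixUnit (childBall j v) w := by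
  rw [mul_matrixUnit, childOp_basisVec, matrixUnit]

/-- Every ball except the root is a child in exactly one way. Hence the vacuum projection lies in
the algebra of the `S_j`, and the Cuntz relation holds modulo compact operators. -/
theorem sum_childOp_mul_star_add (s : ℕ) :
    ∑ j : Fin s, childOp j * star (childOp j) + matrixUnit (rootBall s) (rootBall s) = 1 := by
  refine ballSpace_ext fun v => ?_
  simp only [add_apply, sum_apply, mul_apply_eq_comp, one_apply_eq_self,
    matrixUnit_apply]
  induction v using sAdicBall_induction with
  | root => simp [star_childOp_rootBall]
  | child k v _ =>
    rw [if_neg (childBall_ne_rootBall k v).symm, add_zero]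
    simp only [star_childOp_childBall]
    rw [Finset.sum_eq_single k (fun j _ hj => by simp [hj]) (by simp), if_pos rfl,
      childOp_basisVec]

/-- A closed `*`-algebra that contains the matrix units of the first column contains `𝒦(H)`. -/
theorem compactOperators_le (J : NonUnitalStarSubalgebra ℂ (BallSpace s →L[ℂ] BallSpace s))
    (hJ : IsClosed (J : Set (BallSpace s →L[ℂ] BallSpace s)))
    (h : ∀ v, matrixUnit v (rootBall s) ∈ J) : compactOperators (BallSpace s) ≤ J := by
  have hu : ∀ v w, matrixUnit v w ∈ J := fun v w => by
    rw [← matrixUnit_mul_matrixUnit v (rootBall s) w]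
    refine mul_mem (h v) ?_
    rw [← star_matrixUnit]
    exact star_mem (h w)
  -- General rank one operators are reached one slot at a time: with the other slot fixed, the
  -- admissible vectors form a closed subspace that contains the basis.
  have h1 : ∀ x w, rankOne ℂ x (basisVec w) ∈ J := fun x w => by
    let N : Submodule ℂ (BallSpace s) :=
      { carrier := {x | rankOne ℂ x (basisVec w) ∈ J}
        zero_mem' := by simp
        add_mem' := fun {x y} hx hy => by
          have hx : rankOne ℂ x (basisVec w) ∈ J := hx
          have hy : rankOne ℂ y (basisVec w) ∈ J := hy
          change rankOne ℂ (x + y) (basisVec w) ∈ J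
          rw [map_add, add_apply]
          exact add_mem hx hy
        smul_mem' := fun c x hx => by
          have hx : rankOne ℂ x (basisVec w) ∈ J := hx
          change rankOne ℂ (c • x) (basisVec w) ∈ J
          rw [map_smul, smul_apply]
          exact SMulMemClass.smul_mem c hx }
    have hc : Continuous fun x : BallSpace s => rankOne ℂ x (basisVec w) := by fun_prop
    exact ballSpace_mem_of_isClosed (N := N) (hJ.preimage hc) (fun v => hu v w) x
  have h2 : ∀ x y, rankOne ℂ x y ∈ J := fun x y => by
    let N : Submodule ℂ (BallSpace s) :=
      { carrier := {y | rankOne ℂ x y ∈ J}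
        zero_mem' := by simp
        add_mem' := fun {y z} hy hz => by
          have hy : rankOne ℂ x y ∈ J := hy
          have hz : rankOne ℂ x z ∈ J := hz
          change rankOne ℂ x (y + z) ∈ J
          rw [map_add]
          exact add_mem hy hz
        smul_mem' := fun c y hy => by
          have hy : rankOne ℂ x y ∈ J := hy
          change rankOne ℂ x (c • y) ∈ J
          rw [map_smulₛₗ]
          exact SMulMemClass.smul_mem _ hy }
    have hc : Continuous fun y : BallSpace s => rankOne ℂ x y := by fun_prop
    exact ballSpace_mem_of_isClosed (N := N) (hJ.preimage hc) (fun v => h1 x v) y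
  intro T hT
  exact mem_of_isCompactOperator (J := J.toSubmodule) hJ h2 hT

end BallSpace

/-! ### Multiplication operators inside the algebra of the `S_j` -/

section MulOp

variable {s : ℕ}

theorem diagOp_star (g : SAdicBall s → ℂ) {C : ℝ} (hC : 0 ≤ C) (hg : ∀ v, ‖g v‖ ≤ C)
    (v : SAdicBall s) : star (diagOp g hC hg) (basisVec v) = star (g v) • basisVec v := by
  refine ballSpace_vec_ext fun w => ?_
  rw [inner_apply_eq, star_star, diagOp_basisVec, inner_smul_left, inner_smul_right,
    inner_basisVec]
  split_ifs with h
  · rw [h]; rfl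
  · simp

variable [NeZero s]

theorem mulOp_basisVec (f : C(SAdicInt s, ℂ)) (v : SAdicBall s) :
    mulOp f (basisVec v) = f (SAdicInt.ofNat s v.2) • basisVec v :=
  diagOp_basisVec _ _ _ _

theorem norm_mulOp_le (f : C(SAdicInt s, ℂ)) : ‖mulOp f‖ ≤ ‖f‖ := by
  rw [mulOp, diagOp]
  exact lp.norm_mapCLM_le _ _ _ _

/-- The representation `f ↦ M_f` of `C(ℤ_s)`. -/
noncomputable def mulOpHom (s : ℕ) [NeZero s] :
    C(SAdicInt s, ℂ) →⋆ₐ[ℂ] (BallSpace s →L[ℂ] BallSpace s) where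
  toFun := mulOp
  map_one' := ballSpace_ext fun v => by simp [mulOp_basisVec]
  map_mul' f g := ballSpace_ext fun v => by simp [mulOp_basisVec, smul_smul, mul_comm]
  map_zero' := ballSpace_ext fun v => by simp [mulOp_basisVec]
  map_add' f g := ballSpace_ext fun v => by simp [mulOp_basisVec, add_smul]
  commutes' c := ballSpace_ext fun v => by
    simp [mulOp_basisVec, Algebra.algebraMap_eq_smul_one]
  map_star' f := ballSpace_ext fun v => by
    rw [mulOp_basisVec, mulOp, diagOp_star]
    rfl

theorem continuous_mulOp : Continuous (mulOp : C(SAdicInt s, ℂ) → _) :=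
  AddMonoidHomClass.continuous_of_bound (mulOpHom s) 1 fun f => by
    rw [one_mul]
    exact norm_mulOp_le f

theorem ofNat_childBall (j : Fin s) (v : SAdicBall s) :
    SAdicInt.ofNat s (childBall j v).2 0 = j ∧
      ∀ i, SAdicInt.ofNat s (childBall j v).2 (i + 1) = SAdicInt.ofNat s v.2 i := by
  have hs : 0 < s := j.pos
  refine ⟨?_, fun i => ?_⟩
  · refine Fin.ext ?_
    simp [SAdicInt.ofNat, childBall, Nat.mod_eq_of_lt j.2]
  · simp only [SAdicInt.ofNat, childBall, pow_succ', ← Nat.div_div_eq_div_mul]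
    rw [Nat.mul_add_div hs, Nat.div_eq_of_lt j.2, add_zero]

/-- The map `f ↦ f ∘ σ`, where `σ` deletes the digit of lowest order. -/
noncomputable def shiftComp (f : C(SAdicInt s, ℂ)) : C(SAdicInt s, ℂ) :=
  f.comp ⟨fun x i => x (i + 1), by fun_prop⟩

/-- Passing to the child `j` puts the digit `j` in front, and `σ` deletes it again. The root is not
a child, but its point `0` is fixed by `σ`, which gives the correction term. -/
theorem mulOp_shiftComp (f : C(SAdicInt s, ℂ)) :
    mulOp (shiftComp f) = ∑ j, childOp j * mulOp f * star (childOp j) +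
      f (SAdicInt.ofNat s 0) • matrixUnit (rootBall s) (rootBall s) := by
  refine ballSpace_ext fun v => ?_
  simp only [add_apply, sum_apply, mul_apply_eq_comp, smul_apply,
    matrixUnit_apply, mulOp_basisVec]
  induction v using sAdicBall_induction with
  | root =>
    simp only [star_childOp_rootBall, map_zero, Finset.sum_const_zero, zero_add, if_true]
    congr 1
    refine congrArg f (funext fun i => ?_)
    simp [SAdicInt.ofNat, rootBall]
  | child k v _ =>
    rw [if_neg (childBall_ne_rootBall k v).symm, smul_zero, add_zero]
    simp only [star_childOp_childBall]
    rw [Finset.sum_eq_single k (fun j _ hj => by simp [hj]) (by simp), if_pos rfl,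
      mulOp_basisVec, map_smul, childOp_basisVec]
    congr 1
    exact congrArg f (funext fun i => (ofNat_childBall k v).2 i)

theorem mulOp_ballIndicator (j : Fin s) :
    mulOp (ballIndicator j) = childOp j * star (childOp j) +
      ballIndicator j (SAdicInt.ofNat s 0) • matrixUnit (rootBall s) (rootBall s) := by
  refine ballSpace_ext fun v => ?_
  simp only [add_apply, mul_apply_eq_comp, smul_apply, matrixUnit_apply, mulOp_basisVec]
  induction v using sAdicBall_induction with
  | root =>
    rw [star_childOp_rootBall, map_zero, zero_add, if_pos rfl]
    rfl
  | child k v _ =>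
    rw [if_neg (childBall_ne_rootBall k v).symm, smul_zero, add_zero, star_childOp_childBall]
    simp only [ballIndicator, ContinuousMap.coe_mk, (ofNat_childBall k v).1, eq_comm (a := k)]
    split_ifs with h
    · rw [childOp_basisVec, h, one_smul]
    · simp

/-- The factor `s` cancels `1/s`, and `M_{χ_j}` keeps only the child whose lowest digit is `j`. -/
theorem bernoulliIsometry_coe (j : Fin s) :
    (bernoulliIsometry s j : BallSpace s →L[ℂ] BallSpace s) = childOp j := by
  have hs : (s : ℂ) ≠ 0 := Nat.cast_ne_zero.2 (NeZero.ne s)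
  refine ballSpace_ext fun v => ?_
  change (s : ℂ) • mulOp (ballIndicator j) (bernoulliShift s (basisVec v)) = _
  rw [bernoulliShift_basisVec, map_smul, map_sum, smul_smul, mul_one_div_cancel hs, one_smul,
    childOp_basisVec]
  simp only [mulOp_basisVec, ballIndicator, ContinuousMap.coe_mk, (ofNat_childBall _ v).1]
  rw [Finset.sum_eq_single j (fun k _ hk => by simp [hk]) (by simp), if_pos rfl, one_smul]

/-- A closed `*`-algebra that contains the isometries `S_j` contains all `M_f`. -/
theorem mulOp_mem (A : StarSubalgebra ℂ (BallSpace s →L[ℂ] BallSpace s))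
    (hA : IsClosed (A : Set (BallSpace s →L[ℂ] BallSpace s))) (h : ∀ j, childOp j ∈ A)
    (f : C(SAdicInt s, ℂ)) : mulOp f ∈ A := by
  have hroot : matrixUnit (rootBall s) (rootBall s) ∈ A := by
    rw [eq_sub_of_add_eq' (sum_childOp_mul_star_add s)]
    exact sub_mem (one_mem A) (sum_mem fun j _ => mul_mem (h j) (star_mem (h j)))
  -- `F` consists of the `f` with `M_f ∈ A`. It is closed, so by Stone–Weierstrass it suffices that
  -- it separates points. The indicators of single digits do, and `mulOp_shiftComp` moves them from
  -- digit to digit.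
  let F : StarSubalgebra ℂ C(SAdicInt s, ℂ) := A.comap (mulOpHom s)
  have hF : ∀ (n : ℕ) (j : Fin s), shiftComp^[n] (ballIndicator j) ∈ F := by
    intro n j
    induction n with
    | zero =>
      change mulOp (ballIndicator j) ∈ A
      rw [mulOp_ballIndicator]
      exact add_mem (mul_mem (h j) (star_mem (h j))) (A.smul_mem hroot _)
    | succ n ih =>
      rw [Function.iterate_succ_apply']
      change mulOp (shiftComp _) ∈ A
      rw [mulOp_shiftComp]
      exact add_mem (sum_mem fun k _ => mul_mem (mul_mem (h k) ih) (star_mem (h k)))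
        (A.smul_mem hroot _)
  have hval : ∀ (n : ℕ) (j : Fin s) (x : SAdicInt s),
      shiftComp^[n] (ballIndicator j) x = if x n = j then 1 else 0 := by
    intro n
    induction n with
    | zero => intro j x; rfl
    | succ n ih =>
      intro j x
      rw [Function.iterate_succ_apply']
      exact ih j _
  have hsep : F.SeparatesPoints := by
    intro x y hxy
    obtain ⟨n, hn⟩ := Function.ne_iff.1 hxy
    refine ⟨shiftComp^[n] (ballIndicator (x n)), ⟨_, hF n (x n), rfl⟩, ?_⟩
    simp [hval, hn.symm]
  have htop := ContinuousMap.starSubalgebra_topologicalClosure_eq_top_of_separatesPoints F hsep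
  have hcl : IsClosed (F : Set C(SAdicInt s, ℂ)) := hA.preimage continuous_mulOp
  have : f ∈ F.topologicalClosure := htop ▸ StarSubalgebra.mem_top
  exact hcl.closure_subset this

end MulOp

/-! ### The Fock representation is isometric with range `A_S` -/

section CuntzToeplitz

variable {s : ℕ}

theorem star_cuntzToeplitzGen_mul (j k : Fin s) :
    star (cuntzToeplitzGen s j) * cuntzToeplitzGen s k = if j = k then 1 else 0 :=
  (eval_cuntzToeplitzRelators_iff (cuntzToeplitzGen s)).1
    (UnivCStar.eval_gen_rel (cuntzToeplitzRelators s)) j k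

theorem cuntzGen_relations (s : ℕ) :
    (∀ j k, star (cuntzGen s j) * cuntzGen s k = if j = k then 1 else 0) ∧
      ∑ j, cuntzGen s j * star (cuntzGen s j) = 1 :=
  (eval_cuntzRelators_iff (cuntzGen s)).1 (UnivCStar.eval_gen_rel (cuntzRelators s))

/-- The Fock representation of the Cuntz–Toeplitz algebra on `ℓ²(𝒱)`. -/
noncomputable def fockRep (s : ℕ) :
    CuntzToeplitzAlgebra s →⋆ₐ[ℂ] (BallSpace s →L[ℂ] BallSpace s) :=
  UnivCStar.lift _ childOp ((eval_cuntzToeplitzRelators_iff _).2 star_childOp_mul_childOp)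

theorem fockRep_gen (j : Fin s) : fockRep s (cuntzToeplitzGen s j) = childOp j :=
  UnivCStar.lift_gen _ _ _ j

theorem fockRep_mk (x : PreUnivCStar (cuntzToeplitzRelators s)) :
    fockRep s (UnivCStar.mk _ x) = FreeStarAlg.eval childOp x :=
  UnivCStar.liftFun_mk _ _ ((eval_cuntzToeplitzRelators_iff _).2 star_childOp_mul_childOp) x

/-- The inequality `norm_eval_le_of_vacuum` is applied with the universal generators themselves as
the family `v` and the root vector as vacuum. Density extends it from `*`-polynomials. -/
theorem norm_fockRep (x : CuntzToeplitzAlgebra s) : ‖fockRep s x‖ = ‖x‖ := by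
  have hc : Continuous (fockRep s) := UnivCStar.continuous_liftFun _ _
  refine le_antisymm (NonUnitalStarAlgHom.norm_apply_le _ x) ?_
  induction x using UnivCStar.ind with
  | hc => exact isClosed_le continuous_norm hc.norm
  | h x =>
    rw [fockRep_mk]
    have h := norm_eval_le_of_vacuum star_childOp_mul_childOp star_childOp_rootBall
      (norm_basisVec _) star_cuntzToeplitzGen_mul x
    have e : FreeStarAlg.eval (cuntzToeplitzGen s) x = UnivCStar.mk _ x :=
      congrArg (fun f : FreeStarAlg (Fin s) →⋆ₐ[ℂ] CuntzToeplitzAlgebra s => f x)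
        (UnivCStar.eval_gen (cuntzToeplitzRelators s))
    rwa [e] at h

theorem isometry_fockRep (s : ℕ) : Isometry (fockRep s) :=
  AddMonoidHomClass.isometry_of_norm _ norm_fockRep

variable [NeZero s]

/-- The range is closed because the representation is isometric. It contains the shift and all
`M_f`. Conversely, `*`-polynomials in the `childOp j` are evaluations inside `A_S`. -/
theorem range_fockRep (s : ℕ) [NeZero s] : (fockRep s).range = bernoulliAlgebra s := by
  have hcl : IsClosed ((fockRep s).range : Set (BallSpace s →L[ℂ] BallSpace s)) :=
    (isometry_fockRep s).isClosedEmbedding.isClosed_range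
  have hgen : ∀ j, childOp j ∈ (fockRep s).range := fun j => ⟨_, fockRep_gen j⟩
  refine le_antisymm ?_ ?_
  · rintro _ ⟨x, rfl⟩
    have hc : Continuous (fockRep s) := (isometry_fockRep s).continuous
    change fockRep s x ∈ bernoulliAlgebra s
    induction x using UnivCStar.ind with
    | hc => exact (StarSubalgebra.isClosed_topologicalClosure _).preimage hc
    | h x =>
      rw [fockRep_mk]
      have h : FreeStarAlg.eval childOp =
          (bernoulliAlgebra s).subtype.comp (FreeStarAlg.eval (bernoulliIsometry s)) :=
        FreeStarAlg.starAlgHom_ext fun j => by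
          rw [StarAlgHom.comp_apply, FreeStarAlg.eval_gen, FreeStarAlg.eval_gen]
          exact (bernoulliIsometry_coe j).symm
      rw [h]
      exact (FreeStarAlg.eval (bernoulliIsometry s) x).2
  · refine StarSubalgebra.topologicalClosure_minimal (StarAlgebra.adjoin_le ?_) hcl
    rintro T (rfl | ⟨f, rfl⟩)
    · exact StarSubalgebra.smul_mem _ (sum_mem fun j _ => hgen j) _
    · exact mulOp_mem _ hcl hgen f

theorem fockRep_mem (x : CuntzToeplitzAlgebra s) : fockRep s x ∈ bernoulliAlgebra s := by
  rw [← range_fockRep]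
  exact ⟨x, rfl⟩

/-- The canonical isomorphism from the Cuntz–Toeplitz algebra onto `A_S`. -/
noncomputable def cuntzToeplitzEquiv (s : ℕ) [NeZero s] :
    CuntzToeplitzAlgebra s ≃⋆ₐ[ℂ] bernoulliAlgebra s :=
  StarAlgEquiv.ofBijective ((fockRep s).codRestrict _ fockRep_mem) <| by
    refine ⟨fun x y h => (isometry_fockRep s).injective (congrArg Subtype.val h), ?_⟩
    rintro ⟨T, hT⟩
    rw [← range_fockRep] at hT
    obtain ⟨x, hx⟩ := hT
    exact ⟨x, Subtype.ext hx⟩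

theorem cuntzToeplitzEquiv_gen (j : Fin s) :
    cuntzToeplitzEquiv s (cuntzToeplitzGen s j) = bernoulliIsometry s j :=
  Subtype.ext ((fockRep_gen j).trans (bernoulliIsometry_coe j).symm)

end CuntzToeplitz

/-! ### The ideal `ℐ_S` -/

section BernoulliIdeal

variable {s : ℕ}

theorem matrixUnit_self_mem_invariantCompacts (v : SAdicBall s) :
    matrixUnit v v ∈ invariantCompacts s := by
  refine ⟨matrixUnit_mem_compactOperators v v, fun θ => ballSpace_ext fun w => ?_⟩
  rw [mul_apply_eq_comp, mul_apply_eq_comp, gaugeUnitary, diagOp_star, map_smul, map_smul,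
    matrixUnit_apply]
  split_ifs with h
  · subst h
    rw [diagOp_basisVec, smul_smul]
    have : star (Complex.exp ((2 * Real.pi * v.1 * θ : ℝ) * Complex.I)) *
        Complex.exp ((2 * Real.pi * v.1 * θ : ℝ) * Complex.I) = 1 := by
      rw [Complex.star_def, Complex.conj_mul', Complex.norm_exp_ofReal_mul_I]
      simp
    rw [this, one_smul]
  · simp

theorem star_bernoulliShift_childBall (j : Fin s) (v : SAdicBall s) :
    star (bernoulliShift s) (basisVec (childBall j v)) = (1 / s : ℂ) • basisVec v := by
  rw [bernoulliShift, star_smul, star_sum, smul_apply, sum_apply]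
  simp only [star_childOp_childBall]
  rw [Finset.sum_eq_single j (fun k _ hk => by simp [hk]) (by simp), if_pos rfl]
  simp

/-- The adjoint of the shift sends a ball to `1/s` times its parent, so `v.1` steps climb to the
root. -/
theorem star_bernoulliShift_pow_level (v : SAdicBall s) :
    (star (bernoulliShift s) ^ v.1) (basisVec v) = (1 / s : ℂ) ^ v.1 • basisVec (rootBall s) := by
  induction v using sAdicBall_induction with
  | root => simp [rootBall]
  | child j v ih =>
    change (star (bernoulliShift s) ^ (v.1 + 1)) _ = (1 / s : ℂ) ^ (v.1 + 1) • _
    rw [pow_succ, mul_apply_eq_comp, star_bernoulliShift_childBall, map_smul, ih, smul_smul,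
      pow_succ']

theorem matrixUnit_root_eq [NeZero s] (v : SAdicBall s) :
    matrixUnit v (rootBall s) =
      (s : ℂ) ^ v.1 • (matrixUnit v v * bernoulliShift s ^ v.1) := by
  have hs : (s : ℂ) ≠ 0 := Nat.cast_ne_zero.2 (NeZero.ne s)
  rw [matrixUnit_mul, star_pow, star_bernoulliShift_pow_level, map_smulₛₗ, smul_smul]
  have : (s : ℂ) ^ v.1 * (starRingEnd ℂ) ((1 / s : ℂ) ^ v.1) = 1 := by
    simp [hs]
  rw [this, one_smul, matrixUnit]

/-- The generators `a S^n` are compact. Conversely, `matrixUnit v v` is gauge invariant because it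
is diagonal, so `matrixUnit_root_eq` puts the first column of matrix units into `ℐ_S`. -/
theorem bernoulliIdeal_eq (s : ℕ) [NeZero s] :
    bernoulliIdeal s = compactOperators (BallSpace s) := by
  refine le_antisymm ?_ ?_
  · refine NonUnitalStarSubalgebra.topologicalClosure_minimal _ (NonUnitalStarAlgebra.adjoin_le ?_)
      isClosed_compactOperators
    rintro _ ⟨a, ha, n, rfl⟩
    exact mul_mem_compactOperators_right _ ha.1
  · refine compactOperators_le _ (NonUnitalStarSubalgebra.isClosed_topologicalClosure _) fun v => ?_
    rw [matrixUnit_root_eq]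
    refine SMulMemClass.smul_mem _ (NonUnitalStarSubalgebra.le_topologicalClosure _
      (NonUnitalStarAlgebra.subset_adjoin ℂ _ ?_))
    exact ⟨_, matrixUnit_self_mem_invariantCompacts v, _, rfl⟩

end BernoulliIdeal

/-! ### The quotient by the compact operators is the Cuntz algebra -/

section CuntzQuotient

variable {s : ℕ}

/-- The canonical map from the Cuntz–Toeplitz algebra to the Cuntz algebra. -/
noncomputable def toCuntz (s : ℕ) : CuntzToeplitzAlgebra s →⋆ₐ[ℂ] CuntzAlgebra s :=
  UnivCStar.lift _ (cuntzGen s) ((eval_cuntzToeplitzRelators_iff _).2 (cuntzGen_relations s).1)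

theorem toCuntz_gen (j : Fin s) : toCuntz s (cuntzToeplitzGen s j) = cuntzGen s j :=
  UnivCStar.lift_gen _ _ _ j

theorem toCuntz_mk (x : PreUnivCStar (cuntzToeplitzRelators s)) :
    toCuntz s (UnivCStar.mk _ x) = UnivCStar.mk (cuntzRelators s) x :=
  (UnivCStar.liftFun_mk _ _
    ((eval_cuntzToeplitzRelators_iff _).2 (cuntzGen_relations s).1) x).trans
    (congrArg (fun f : FreeStarAlg (Fin s) →⋆ₐ[ℂ] CuntzAlgebra s => f x)
      (UnivCStar.eval_gen (cuntzRelators s)))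

theorem continuous_toCuntz (s : ℕ) : Continuous (toCuntz s) := UnivCStar.continuous_liftFun _ _

/-- The norm of the Calkin algebra, as a C⋆-seminorm on the free `*`-algebra. -/
noncomputable def calkinSeminorm (s : ℕ) : CStarSeminorm (cuntzRelators s) where
  p := (essentialNorm (BallSpace s)).comp
    (FreeStarAlg.eval (childOp (s := s))).toAlgHom.toLinearMap
  mul_le x y := by
    change essentialNorm _ (FreeStarAlg.eval childOp (x * y)) ≤ _
    rw [map_mul]
    exact essentialNorm_mul_le _ _
  star_mul_self x := by
    change essentialNorm _ (FreeStarAlg.eval childOp (star x * x)) = _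
    rw [map_mul, map_star]
    exact essentialNorm_star_mul_self _
  rel r hr := by
    change essentialNorm _ (FreeStarAlg.eval childOp r) = 0
    rw [essentialNorm_eq_zero_iff]
    rcases hr with rfl | hr
    -- The additional Cuntz relator evaluates to minus the vacuum projection, which is compact.
    · have h : FreeStarAlg.eval childOp (∑ j : Fin s,
          FreeStarAlg.gen j * star (FreeStarAlg.gen j) - 1) =
          -matrixUnit (rootBall s) (rootBall s) := by
        rw [map_sub, map_sum, map_one, ← sum_childOp_mul_star_add s]
        simp [map_mul, map_star, FreeStarAlg.eval_gen]
      rw [h]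
      exact neg_mem (matrixUnit_mem_compactOperators _ _)
    · rw [(eval_cuntzToeplitzRelators_iff _).2 star_childOp_mul_childOp r hr]
      exact zero_mem _

/-- On `*`-polynomials the norm of `𝒪_s` is the largest C⋆-seminorm that vanishes on the Cuntz
relators, and `calkinSeminorm` is one of these. -/
theorem essentialNorm_fockRep_le (x : CuntzToeplitzAlgebra s) :
    essentialNorm _ (fockRep s x) ≤ ‖toCuntz s x‖ := by
  induction x using UnivCStar.ind with
  | hc =>
    exact isClosed_le (continuous_essentialNorm.comp (isometry_fockRep s).continuous)
      (continuous_toCuntz s).norm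
  | h x =>
    rw [fockRep_mk, toCuntz_mk]
    exact (PreUnivCStar.p_le_norm _ (calkinSeminorm s) x).trans_eq
      (UnivCStar.norm_mk (cuntzRelators s) x).symm

variable (s) in
/-- The image in `B(H)` of the kernel of the map to the Cuntz algebra. -/
noncomputable def toCuntzKer : NonUnitalStarSubalgebra ℂ (BallSpace s →L[ℂ] BallSpace s) where
  carrier := fockRep s '' {x | toCuntz s x = 0}
  add_mem' := by
    rintro _ _ ⟨x, hx : toCuntz s x = 0, rfl⟩ ⟨y, hy : toCuntz s y = 0, rfl⟩
    refine ⟨x + y, ?_, map_add _ _ _⟩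
    change toCuntz s (x + y) = 0
    rw [map_add, hx, hy, add_zero]
  zero_mem' := ⟨0, map_zero _, map_zero _⟩
  mul_mem' := by
    rintro _ _ ⟨x, hx : toCuntz s x = 0, rfl⟩ ⟨y, hy : toCuntz s y = 0, rfl⟩
    refine ⟨x * y, ?_, map_mul _ _ _⟩
    change toCuntz s (x * y) = 0
    rw [map_mul, hx, zero_mul]
  smul_mem' := by
    rintro c _ ⟨x, hx : toCuntz s x = 0, rfl⟩
    refine ⟨c • x, ?_, map_smul _ _ _⟩
    change toCuntz s (c • x) = 0
    rw [map_smul, hx, smul_zero]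
  star_mem' := by
    rintro _ ⟨x, hx : toCuntz s x = 0, rfl⟩
    refine ⟨star x, ?_, map_star _ _⟩
    change toCuntz s (star x) = 0
    rw [map_star, hx, star_zero]

/-- The vacuum projection is the image of `1 - ∑ t_j t_j^*`, which dies in `𝒪_s`. Multiplying by the
`t_j` on the left gives the rest of the first column. The image of the kernel is closed because the
Fock representation is isometric. -/
theorem compactOperators_le_toCuntzKer (s : ℕ) :
    compactOperators (BallSpace s) ≤ toCuntzKer s := by
  refine compactOperators_le _ ((isometry_fockRep s).isClosedEmbedding.isClosedMap _
    (isClosed_singleton.preimage (continuous_toCuntz s))) fun v => ?_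
  induction v using sAdicBall_induction with
  | root =>
    refine ⟨1 - ∑ j, cuntzToeplitzGen s j * star (cuntzToeplitzGen s j), ?_, ?_⟩
    · change toCuntz s _ = 0
      simp only [map_sub, map_one, map_sum, map_mul, map_star, toCuntz_gen,
        (cuntzGen_relations s).2, sub_self]
    · simp only [map_sub, map_one, map_sum, map_mul, map_star, fockRep_gen]
      exact (eq_sub_of_add_eq' (sum_childOp_mul_star_add s)).symm
  | child j v ih =>
    obtain ⟨x, hx, hxv⟩ := ih
    have hx : toCuntz s x = 0 := hx
    refine ⟨cuntzToeplitzGen s j * x, ?_, ?_⟩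
    · change toCuntz s _ = 0
      rw [map_mul, hx, mul_zero]
    · rw [map_mul, fockRep_gen, hxv, childOp_mul_matrixUnit]

theorem toCuntz_eq_zero_iff (x : CuntzToeplitzAlgebra s) :
    toCuntz s x = 0 ↔ fockRep s x ∈ compactOperators (BallSpace s) := by
  refine ⟨fun h => ?_, fun h => ?_⟩
  · rw [← essentialNorm_eq_zero_iff]
    refine le_antisymm ((essentialNorm_fockRep_le x).trans ?_) (apply_nonneg _ _)
    rw [h, norm_zero]
  · obtain ⟨y, hy, hyx⟩ := compactOperators_le_toCuntzKer s h
    rwa [← (isometry_fockRep s).injective hyx]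

/-- The range is dense, and each of its elements has a preimage of norm at most twice its own:
subtract from any preimage the element of the kernel that corresponds to a nearly optimal compact
operator. Completeness then lifts limits. -/
theorem toCuntz_surjective (s : ℕ) : Function.Surjective (toCuntz s) := by
  let f : NormedAddGroupHom (CuntzToeplitzAlgebra s) (CuntzAlgebra s) :=
    (toCuntz s : CuntzToeplitzAlgebra s →+ CuntzAlgebra s).mkNormedAddGroupHom 1 fun x => by
      rw [one_mul]
      exact NonUnitalStarAlgHom.norm_apply_le (toCuntz s) x
  have hf : f.SurjectiveOnWith f.range 2 := by
    rintro _ ⟨x, rfl⟩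
    change ∃ y, toCuntz s y = toCuntz s x ∧ ‖y‖ ≤ 2 * ‖toCuntz s x‖
    by_cases h0 : toCuntz s x = 0
    · exact ⟨0, by rw [map_zero, h0], by simp⟩
    -- Any factor above `1` would do. It makes the inequality strict, as needed to choose `K`.
    have hlt : essentialNorm _ (fockRep s x) < 2 * ‖toCuntz s x‖ :=
      (essentialNorm_fockRep_le x).trans_lt (by linarith [norm_pos_iff.2 h0])
    obtain ⟨K, hK, hxK⟩ := exists_norm_sub_lt_of_essentialNorm _ hlt
    obtain ⟨k, hk, rfl⟩ := compactOperators_le_toCuntzKer s hK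
    have hk : toCuntz s k = 0 := hk
    refine ⟨x - k, by rw [map_sub, hk, sub_zero], ?_⟩
    rw [← norm_fockRep, map_sub]
    exact hxK.le
  have hd : Dense (f.range : Set (CuntzAlgebra s)) := by
    refine (UnivCStar.denseRange_mk (cuntzRelators s)).mono ?_
    rintro _ ⟨x, rfl⟩
    exact ⟨UnivCStar.mk _ x, toCuntz_mk x⟩
  intro z
  obtain ⟨x, hx, -⟩ := controlled_closure_of_complete two_pos one_pos hf z (hd z)
  exact ⟨x, hx⟩

variable [NeZero s]

/-- The quotient map from `A_S` to the Cuntz algebra. -/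
noncomputable def bernoulliToCuntz (s : ℕ) [NeZero s] :
    bernoulliAlgebra s →⋆ₐ[ℂ] CuntzAlgebra s :=
  (toCuntz s).comp (cuntzToeplitzEquiv s).symm.toStarAlgHom

theorem bernoulliToCuntz_apply (x : CuntzToeplitzAlgebra s) :
    bernoulliToCuntz s (cuntzToeplitzEquiv s x) = toCuntz s x :=
  congrArg (toCuntz s) ((cuntzToeplitzEquiv s).symm_apply_apply x)

theorem bernoulliToCuntz_eq_zero_iff (a : bernoulliAlgebra s) :
    bernoulliToCuntz s a = 0 ↔ a ∈ compactIdeal s := by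
  obtain ⟨x, rfl⟩ := EquivLike.surjective (cuntzToeplitzEquiv s) a
  rw [bernoulliToCuntz_apply, toCuntz_eq_zero_iff]
  rfl

theorem bernoulliToCuntz_surjective (s : ℕ) [NeZero s] :
    Function.Surjective (bernoulliToCuntz s) :=
  (toCuntz_surjective s).comp (EquivLike.surjective (cuntzToeplitzEquiv s).symm)

theorem mem_bernoulliAlgebra_of_compact {T : BallSpace s →L[ℂ] BallSpace s}
    (hT : T ∈ compactOperators (BallSpace s)) : T ∈ bernoulliAlgebra s := by
  obtain ⟨x, -, rfl⟩ := compactOperators_le_toCuntzKer s hT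
  exact fockRep_mem x

/-- The inclusion of the compact operators into `A_S`. -/
noncomputable def compactInclusion (s : ℕ) [NeZero s] :
    compactOperators (BallSpace s) →⋆ₙₐ[ℂ] bernoulliAlgebra s where
  toFun T := ⟨T, mem_bernoulliAlgebra_of_compact T.2⟩
  map_smul' _ _ := rfl
  map_zero' := rfl
  map_add' _ _ := rfl
  map_mul' _ _ := rfl
  map_star' _ := rfl

/-- The isomorphism `A_S / 𝒦(H) ≅ 𝒪_s`. -/
noncomputable def quotientEquivCuntz (s : ℕ) [NeZero s] :
    (bernoulliAlgebra s ⧸ compactIdeal s) ≃⋆ₐ[ℂ] CuntzAlgebra s :=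
  let φ := Ideal.Quotient.liftₐ (compactIdeal s) (bernoulliToCuntz s).toAlgHom
    fun a ha => (bernoulliToCuntz_eq_zero_iff a).2 ha
  StarAlgEquiv.ofBijective
    ({ φ with
        map_star' := by
          rintro ⟨a⟩
          exact map_star (bernoulliToCuntz s) a } :
      (bernoulliAlgebra s ⧸ compactIdeal s) →⋆ₐ[ℂ] CuntzAlgebra s) <| by
    refine ⟨?_, fun z => ?_⟩
    · refine (injective_iff_map_eq_zero φ).2 ?_
      rintro ⟨a⟩ ha
      exact Ideal.Quotient.eq_zero_iff_mem.2 ((bernoulliToCuntz_eq_zero_iff a).1 ha)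
    · obtain ⟨a, rfl⟩ := bernoulliToCuntz_surjective s z
      exact ⟨Ideal.Quotient.mk _ a, rfl⟩

end CuntzQuotient

theorem mainTheorem12 (s : ℕ) [NeZero s] (hs : 2 ≤ s) :
    -- `A_S` is the Cuntz–Toeplitz algebra, with canonical generators the `S_j`
    (∃ Θ : CuntzToeplitzAlgebra s ≃⋆ₐ[ℂ] bernoulliAlgebra s,
      ∀ j, Θ (cuntzToeplitzGen s j) = bernoulliIsometry s j) ∧
    -- the ideal `ℐ_S` is `𝒦(H)`
    bernoulliIdeal s = compactOperators (BallSpace s) ∧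
    -- the isomorphism `A_S / 𝒦(H) ≅ 𝒪_s` and the extension `0 → 𝒦(H) → A_S → 𝒪_s → 0`
    ∃ (i : compactOperators (BallSpace s) →⋆ₙₐ[ℂ] bernoulliAlgebra s)
      (q : bernoulliAlgebra s →⋆ₐ[ℂ] CuntzAlgebra s)
      (Φ : (bernoulliAlgebra s ⧸ compactIdeal s) ≃⋆ₐ[ℂ] CuntzAlgebra s),
      (∀ T, (i T : BallSpace s →L[ℂ] BallSpace s) = T) ∧
      (∀ j, q (bernoulliIsometry s j) = cuntzGen s j) ∧
      (∀ a, Φ (Ideal.Quotient.mk (compactIdeal s) a) = q a) ∧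
      Function.Injective i ∧
      Set.range i = {a | q a = 0} ∧
      Function.Surjective q := by
  refine ⟨⟨cuntzToeplitzEquiv s, cuntzToeplitzEquiv_gen⟩, bernoulliIdeal_eq s,
    compactInclusion s, bernoulliToCuntz s, quotientEquivCuntz s, fun _ => rfl, fun j => ?_,
    fun _ => rfl, fun T T' h => ?_, ?_, bernoulliToCuntz_surjective s⟩
  · rw [← cuntzToeplitzEquiv_gen, bernoulliToCuntz_apply, toCuntz_gen]
  · exact Subtype.ext (congrArg (fun a : bernoulliAlgebra s => a.1) h)
  · ext a
    refine Iff.trans ⟨?_, fun h => ?_⟩ (bernoulliToCuntz_eq_zero_iff a).symm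
    · rintro ⟨T, rfl⟩
      exact T.2
    · exact ⟨⟨a, h⟩, rfl⟩
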